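/- **Setting.** Let $\mathcal S,\mathcal A$ be finite nonempty sets, $p(\cdot\mid s,a)$ transition probabilities on $\mathcal S$, $\gamma\in(0,1)$, $R^*>0$, and let $r:\mathcal S\times\mathcal A\to[-R^*,R^*]$ be a reward function. A policy $\pi$ assigns to each state $s$ a probability distribution $\pi(\cdot\mid s)$ on $\mathcal A$. For policies $\pi_{h-1},\dots,\pi_0$ and an initial distribution $\rho$ put $V_h^{\{\pi_{h-1},\dots,\pi_0\}}(\rho)=\mathbb E\big[\sum_{t=0}^{h-1}\gamma^t r(S_t,A_t)\big]$, where $S_0\sim\rho$, $A_t\sim\pi_{h-t-1}(\cdot\mid S_t)$, $S_{t+1}\sim p(\cdot\mid S_t,A_t)$; $V_0\equiv0$. Let $V_\infty^\pi$ be the infinite-horizon discounted value of the stationary policy $\pi$, let $V(s)=V(\delta_s)$ for each of these value functions, and let $V_\infty^*(s)=\sup_\pi V_\infty^\pi(s)$. Let $\mu$ be a probability distribution on $\mathcal S$ with $\mu(s)>0$ for all $s$, and $\|1/\mu\|_\infty=\max_s 1/\mu(s)$. Let $\pi_\theta(a\mid s)=e^{\theta(s,a)}/\sum_{a'}e^{\theta(s,a')}$,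 $\theta\in\mathbb R^{\mathcal S\times\mathcal A}$, be the tabular softmax policies. **Algorithm (softmax DynPG with exact gradients).** For $h=0,1,2,\dots$: choose a $\theta_0$ (possibly depending on $h$) for which $\pi_{\theta_0}(\cdot\mid s)$ is uniform for every $s$; perform $N_h$ steps $\theta_{n+1}=\theta_n+\eta_h\nabla_\theta V_{h+1}^{\{\pi_\theta,\hat\pi^*_{h-1},\dots,\hat\pi^*_0\}}(\mu)\big|_{\theta=\theta_n}$; put $\hat\pi^*_h=\pi_{\theta_{N_h}}$. Write $\hat{\boldsymbol\pi}^*_H=\{\hat\pi^*_{H-1},\dots,\hat\pi^*_0\}$. **Parameters.** For $\varepsilon>0$, $d>0$, $H\ge 1$ and $0\le h<H$ let $$\eta_h=\frac{1-\gamma}{2R^*(1-\gamma^{h+1})},\qquad n_h(e)=\frac{4R^*(1-\gamma^{h+1})|\mathcal A|^2}{(1-\gamma)\,e}\Big\|\frac1\mu\Big\|_\infty,$$ $$\tau_h(d,H)=d\Big(\sum_{t=0}^{H-1}\big((1-\gamma^{t+1})\gamma^{H-t-1}\big)^{1/2}\Big)^{-1}\Big(\frac{\gamma^{H-h-1}}{1-\gamma^{h+1}}\Big)^{-1/2},$$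 with $\eta_h$ and $n_h(e)$ defined by the same formulas for all $h\ge0$, $e>0$. Write $\lceil x\rceil_+=\max(\lceil x\rceil,0)$. **Theorem.** Let $\varepsilon>0$. 1. *(Overall error.)* Let $H=\big\lceil\log_\gamma\frac{(1-\gamma)^2\varepsilon}{6R^*}\big\rceil_+$, $\varepsilon_h=\tau_h\big(\tfrac{(1-\gamma)\varepsilon}{6},H\big)$ for $h<H$, and $\varepsilon_H=\frac{(1-\gamma)\varepsilon}{6}$. Run DynPG with step sizes $\eta_h$, $0\le h\le H$. Then $\|V_\infty^*-V_\infty^{\hat\pi^*_H}\|_\infty\le\varepsilon$ both for $N_h=\lceil n_h(\varepsilon_h)\rceil$ and for $N_h=\lfloor n_h(\varepsilon_h)\rfloor$ $(0\le h\le H)$. Moreover $$\sum_{h=0}^{H}N_h\le\frac{48R^*|\mathcal A|^2}{(1-\gamma)^3\varepsilon}\Big\lceil\frac{\log\big(6R^*(1-\gamma)^{-2}\varepsilon^{-1}\big)}{\log(\gamma^{-1})}\Big\rceil_+\Big\|\frac1\mu\Big\|_\infty$$ holds for $N_h=\lceil n_h(\varepsilon_h)\rceil$ if $H\ge2$, and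 for $N_h=\lfloor n_h(\varepsilon_h)\rfloor$ if $H\ge1$. If $H=0$ (that is, $\varepsilon\ge 6R^*/(1-\gamma)^2$), then already $N_0=0$ gives $\|V_\infty^*-V_\infty^{\hat\pi^*_0}\|_\infty\le\varepsilon$. 2. *(Value function error.)* Let $H=\big\lceil\log_\gamma\frac{(1-\gamma)\varepsilon}{2R^*}\big\rceil_+$ and $\varepsilon_h=\tau_h\big(\tfrac{\varepsilon}{2},H\big)$ for $h<H$. Run DynPG with step sizes $\eta_h$, $0\le h<H$. Then $\|V_\infty^*-V_H^{\hat{\boldsymbol\pi}^*_H}\|_\infty\le\varepsilon$ both for $N_h=\lceil n_h(\varepsilon_h)\rceil$ and for $N_h=\lfloor n_h(\varepsilon_h)\rfloor$ $(0\le h<H)$. Moreover $$\sum_{h=0}^{H-1}N_h\le\frac{8R^*|\mathcal A|^2}{(1-\gamma)^2\varepsilon}\Big\lceil\frac{\log\big(2R^*(1-\gamma)^{-1}\varepsilon^{-1}\big)}{\log(\gamma^{-1})}\Big\rceil_+\Big\|\frac1\mu\Big\|_\infty$$ holds for $N_h=\lceil n_h(\varepsilon_h)\rceil$ if $H\ge2$,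 and for $N_h=\lfloor n_h(\varepsilon_h)\rfloor$ for every $H$. -/

import Mathlib

open scoped Gradient

/-- A discounted Markov decision process with state space `S` and action space `A`: transition
probabilities `p(· | s, a)`, rewards `r(s, a)` and a discount factor in `(0, 1)`. -/
structure MDP (S A : Type*) [Fintype S] where
  trans : S → A → stdSimplex ℝ S
  reward : S → A → ℝ
  discount : ℝ
  discount_pos : 0 < discount
  discount_lt_one : discount < 1

/-- A (stochastic, Markov, stationary) policy: `π s a` is the probability `π(a | s)`. -/
abbrev Policy (S A : Type*) [Fintype A] : Type _ := S → stdSimplex ℝ A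

noncomputable section

namespace MDP

variable {S A : Type*} [Fintype S] [Fintype A]

/-- The probability of the trajectory `τ = ((S₀, A₀), …, (Sₙ₋₁, Aₙ₋₁))` when `S₀ ∼ ρ`,
`Aₜ ∼ σ t (· | Sₜ)` and `Sₜ₊₁ ∼ p(· | Sₜ, Aₜ)`. -/
def trajProb (M : MDP S A) :
    {n : ℕ} → stdSimplex ℝ S → (Fin n → Policy S A) → (Fin n → S × A) → ℝ
  | 0, _, _, _ => 1
  | _ + 1, ρ, σ, τ =>
      ρ (τ 0).1 * σ 0 (τ 0).1 (τ 0).2 *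
        M.trajProb (M.trans (τ 0).1 (τ 0).2) (Fin.tail σ) (Fin.tail τ)

/-- The `n`-step value function: the expected discounted reward `E[∑_{t<n} γ^t r(Sₜ, Aₜ)]` when the
initial distribution is `ρ` and the policy used at time `t` is `σ t`. A non-stationary policy
`{π_{n-1}, …, π_0}` is the family `σ t = π_{n-1-t}`. -/
def value (M : MDP S A) {n : ℕ} (ρ : stdSimplex ℝ S) (σ : Fin n → Policy S A) : ℝ :=
  ∑ τ : Fin n → S × A,
    M.trajProb ρ σ τ * ∑ t : Fin n, M.discount ^ (t : ℕ) * M.reward (τ t).1 (τ t).2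

/-- `E[r(Sₜ, Aₜ)]` for initial distribution `ρ` under the stationary policy `π`. -/
def expectedReward (M : MDP S A) (ρ : stdSimplex ℝ S) (π : Policy S A) (t : ℕ) : ℝ :=
  ∑ τ : Fin (t + 1) → S × A,
    M.trajProb ρ (fun _ => π) τ * M.reward (τ (Fin.last t)).1 (τ (Fin.last t)).2

/-- The infinite-horizon value `∑ₜ γ^t E[r(Sₜ, Aₜ)]` of the stationary policy `π`
(the series converges absolutely since there are finitely many rewards). -/
def valueInf (M : MDP S A) (ρ : stdSimplex ℝ S) (π : Policy S A) : ℝ :=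
  ∑' t : ℕ, M.discount ^ t * M.expectedReward ρ π t

/-- The optimal infinite-horizon value `V*_∞`, the supremum over all stationary policies. -/
def optValue (M : MDP S A) (ρ : stdSimplex ℝ S) : ℝ :=
  ⨆ π : Policy S A, M.valueInf ρ π

end MDP

section Algorithm

variable {S A : Type*} [Fintype S] [Fintype A]

/-- The tabular softmax policy with logits `θ`. -/
def softmaxPolicy [Nonempty A] (θ : EuclideanSpace ℝ (S × A)) : Policy S A := fun s =>
  ⟨fun a => Real.exp (θ (s, a)) / ∑ a' : A, Real.exp (θ (s, a')), by
    refine ⟨fun a => by positivity, ?_⟩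
    rw [← Finset.sum_div]
    exact div_self (Finset.sum_pos (fun a _ => Real.exp_pos _) Finset.univ_nonempty).ne'⟩

/-- Gradient ascent `θ_{n+1} = θ_n + η ∇ f(θ_n)` with exact gradients, started in `θ₀`. -/
def gradAscent {E : Type*} [NormedAddCommGroup E] [InnerProductSpace ℝ E] [CompleteSpace E]
    (f : E → ℝ) (η : ℝ) (θ₀ : E) : ℕ → E
  | 0 => θ₀
  | n + 1 => gradAscent f η θ₀ n + η • ∇ f (gradAscent f η θ₀ n)

/-- The policy found by one epoch of softmax DynPG: `N` steps of size `η` of exact gradient ascent,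
started in `θ₀`, on `θ ↦ V_{h+1}^{{π_θ, Λ}}(μ)`, where `Λ` holds the `h` policies that are applied
after the first action. -/
def dynPGEpoch [Nonempty A] (M : MDP S A) (μ : stdSimplex ℝ S) {h : ℕ} (Λ : Fin h → Policy S A)
    (η : ℝ) (θ₀ : EuclideanSpace ℝ (S × A)) (N : ℕ) : Policy S A :=
  softmaxPolicy (gradAscent (fun θ => M.value μ (Fin.cons (softmaxPolicy θ) Λ)) η θ₀ N)

/-- The memory of softmax DynPG before epoch `h`, that is, the non-stationary policy
`{π̂*_{h-1}, …, π̂*_0}`. Epoch `h` uses step size `η h`, initialization `θ₀ h` and `N h` gradient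
steps, and its policy is put in front of the earlier ones. -/
def dynPGMemory [Nonempty A] (M : MDP S A) (μ : stdSimplex ℝ S) (η : ℕ → ℝ)
    (θ₀ : ℕ → EuclideanSpace ℝ (S × A)) (N : ℕ → ℕ) : (h : ℕ) → Fin h → Policy S A
  | 0 => Fin.elim0
  | h + 1 =>
      Fin.cons (dynPGEpoch M μ (dynPGMemory M μ η θ₀ N h) (η h) (θ₀ h) (N h))
        (dynPGMemory M μ η θ₀ N h)

/-- The policy `π̂*_h` trained by softmax DynPG in epoch `h`. -/
def dynPGPolicy [Nonempty A] (M : MDP S A) (μ : stdSimplex ℝ S) (η : ℕ → ℝ)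
    (θ₀ : ℕ → EuclideanSpace ℝ (S × A)) (N : ℕ → ℕ) (h : ℕ) : Policy S A :=
  dynPGEpoch M μ (dynPGMemory M μ η θ₀ N h) (η h) (θ₀ h) (N h)

/-- The value function error `‖V*_∞ - V_H^{{π̂*_{H-1}, …, π̂*_0}}‖_∞` of softmax DynPG. -/
def valueError [DecidableEq S] [Nonempty A] (M : MDP S A) (μ : stdSimplex ℝ S) (η : ℕ → ℝ)
    (θ₀ : ℕ → EuclideanSpace ℝ (S × A)) (N : ℕ → ℕ) (H : ℕ) : ℝ :=
  ‖fun s : S => M.optValue (stdSimplex.vertex s) -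
    M.value (stdSimplex.vertex s) (dynPGMemory M μ η θ₀ N H)‖

/-- The overall error `‖V*_∞ - V_∞^{π̂*_H}‖_∞` of softmax DynPG. -/
def overallError [DecidableEq S] [Nonempty A] (M : MDP S A) (μ : stdSimplex ℝ S) (η : ℕ → ℝ)
    (θ₀ : ℕ → EuclideanSpace ℝ (S × A)) (N : ℕ → ℕ) (H : ℕ) : ℝ :=
  ‖fun s : S => M.optValue (stdSimplex.vertex s) -
    M.valueInf (stdSimplex.vertex s) (dynPGPolicy M μ η θ₀ N H)‖

end Algorithm

section Parameters

/-- The step size `η_h = (1 - γ) / (2 R* (1 - γ^{h+1}))`. -/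
def stepSize (γ R : ℝ) (h : ℕ) : ℝ := (1 - γ) / (2 * R * (1 - γ ^ (h + 1)))

/-- The error tolerances
`d (∑_{t<H} √((1 - γ^{t+1}) γ^{H-t-1}))⁻¹ (γ^{H-h-1} / (1 - γ^{h+1}))^{-1/2}`, `h < H`. -/
def tolerance (γ d : ℝ) (H h : ℕ) : ℝ :=
  d * (∑ t ∈ Finset.range H, √((1 - γ ^ (t + 1)) * γ ^ (H - t - 1)))⁻¹ *
    (√(γ ^ (H - h - 1) / (1 - γ ^ (h + 1))))⁻¹

/-- The number of gradient steps of epoch `h` before rounding, for error tolerance `e`: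
`4 R* (1 - γ^{h+1}) |A|² ‖1/μ‖_∞ / ((1 - γ) e)`; here `K = |A|` and `m = ‖1/μ‖_∞`. -/
def stepCount (γ R m : ℝ) (K : ℕ) (e : ℝ) (h : ℕ) : ℝ :=
  4 * R * (1 - γ ^ (h + 1)) * (K : ℝ) ^ 2 / ((1 - γ) * e) * m

/-- The horizon for the value function error, `⌈log_γ((1 - γ) ε / (2 R*))⌉`
(`0` if the logarithm is negative). -/
def valueHorizon (γ R ε : ℝ) : ℕ := ⌈Real.logb γ ((1 - γ) * ε / (2 * R))⌉₊

/-- The step counts before rounding for the value function error, `h < H`. -/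
def valueStepCount (γ R m : ℝ) (K : ℕ) (ε : ℝ) (h : ℕ) : ℝ :=
  stepCount γ R m K (tolerance γ (ε / 2) (valueHorizon γ R ε) h) h

/-- The horizon for the overall error, `⌈log_γ((1 - γ)² ε / (6 R*))⌉`
(`0` if the logarithm is negative). -/
def overallHorizon (γ R ε : ℝ) : ℕ := ⌈Real.logb γ ((1 - γ) ^ 2 * ε / (6 * R))⌉₊

/-- The error tolerances `ε_h` for the overall error, `h ≤ H`. -/
def overallTolerance (γ R ε : ℝ) (h : ℕ) : ℝ :=
  if h < overallHorizon γ R ε then tolerance γ (ε * (1 - γ) / 6) (overallHorizon γ R ε) h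
  else (1 - γ) * ε / 6

/-- The step counts before rounding for the overall error, `h ≤ H`. -/
def overallStepCount (γ R m : ℝ) (K : ℕ) (ε : ℝ) (h : ℕ) : ℝ :=
  stepCount γ R m K (overallTolerance γ R ε h) h

/-- The bound on the total number of gradient steps for the value function error. -/
def valueBound (γ R m : ℝ) (K : ℕ) (ε : ℝ) : ℝ :=
  8 * R * (K : ℝ) ^ 2 / ((1 - γ) ^ 2 * ε) *
    (⌈Real.log (2 * R / ((1 - γ) * ε)) / Real.log (1 / γ)⌉₊ : ℝ) * m

/-- The bound on the total number of gradient steps for the overall error. -/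
def overallBound (γ R m : ℝ) (K : ℕ) (ε : ℝ) : ℝ :=
  48 * R * (K : ℝ) ^ 2 / ((1 - γ) ^ 3 * ε) *
    (⌈Real.log (6 * R / ((1 - γ) ^ 2 * ε)) / Real.log (1 / γ)⌉₊ : ℝ) * m

end Parameters

end

/-! With the memory `Λ` frozen, the objective of an epoch is `∑ s, μ s * ∑ a, π(a|s) q(s,a)`, where
`q` depends only on `Λ`. It decouples over states, so gradient ascent runs an independent softmax
bandit in every state, with step size `η * μ s`. Since `|q| ≤ b` for `b = R(1-γ^{h+1})/(1-γ)` and `η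
= 1/(2b)`, every bandit is in the small-step regime.

For a bandit with gap `δ`, one gradient step is an exponential-weights update whose exponents have
the signs of the advantages. It gains at least half of the first-order prediction
(`mean_exp_weights_ge`). From a uniform start the best action keeps the largest logit, hence
probability at least `1/|A|`, so `δ` falls by at least `δ²/C` with `C = 2|A|²/α`, where `α` is the
step size. This gives `δ ≤ C/(n+1)` after `n` steps (`softmax_bandit_error_le`). The `+1` is why
rounding the step counts down is harmless.

An epoch is therefore greedy up to its tolerance `e_h`, and the Bellman contraction gives `D_{h+1} ≤
γ D_h + e_h` for the value error. Half of the error budget goes to the truncation `γ^H R/(1-γ)`,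
half to the weighted tolerances. Using the last policy forever costs `(2γD + e)/(1-γ)`
(`MDP.optValue_sub_valueInf_le`).

The tolerances minimise the total work `∑ (1-γ^{h+1})/e_h` subject to `∑ γ^{H-h-1} e_h = d`. The
minimum is `toleranceSum² / d`, and Cauchy-Schwarz bounds `toleranceSum²` by `H/(1-γ)`. Rounding up
adds at most one step per epoch. The slack in Cauchy-Schwarz pays for this in the value bound, the
spare factor 2 in the overall bound. -/

/-! ### Trajectory sums and their one-step recursions -/

section Trajectories

variable {S A : Type*} [Fintype S] [Fintype A]

theorem sum_fin_succ_fun {X : Type*} [Fintype X] {n : ℕ} (f : (Fin (n + 1) → X) → ℝ) :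
    ∑ τ, f τ = ∑ x : X, ∑ τ : Fin n → X, f (Fin.cons x τ) := by
  rw [← (Fin.consEquiv (fun _ => X)).sum_comp, Fintype.sum_prod_type]
  rfl

theorem MDP.trajProb_cons (M : MDP S A) {n : ℕ} (ρ : stdSimplex ℝ S)
    (σ : Fin (n + 1) → Policy S A) (x : S × A) (τ : Fin n → S × A) :
    M.trajProb ρ σ (Fin.cons x τ) =
      ρ x.1 * σ 0 x.1 x.2 * M.trajProb (M.trans x.1 x.2) (Fin.tail σ) τ := by
  simp [MDP.trajProb]

theorem sum_initial_action (ρ : stdSimplex ℝ S) (π : Policy S A) (g : S → A → ℝ) :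
    ∑ x : S × A, ρ x.1 * π x.1 x.2 * g x.1 x.2 = ∑ s, ρ s * ∑ a, π s a * g s a := by
  rw [Fintype.sum_prod_type]
  simp only [Finset.mul_sum, mul_assoc]

theorem MDP.sum_trajProb (M : MDP S A) {n : ℕ} (ρ : stdSimplex ℝ S) (σ : Fin n → Policy S A) :
    ∑ τ, M.trajProb ρ σ τ = 1 := by
  induction n generalizing ρ with
  | zero => simp [MDP.trajProb]
  | succ n ih =>
    rw [sum_fin_succ_fun]
    simp only [M.trajProb_cons, ← Finset.mul_sum, ih]
    rw [sum_initial_action ρ (σ 0) (fun _ _ => 1)]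
    simp

theorem MDP.value_zero (M : MDP S A) (ρ : stdSimplex ℝ S) (σ : Fin 0 → Policy S A) :
    M.value ρ σ = 0 := by
  simp [MDP.value]

/-- Condition on the first state and action. The immediate reward becomes an average over the
remaining trajectory because trajectory probabilities sum to 1. -/
theorem MDP.value_succ (M : MDP S A) {n : ℕ} (ρ : stdSimplex ℝ S)
    (σ : Fin (n + 1) → Policy S A) :
    M.value ρ σ = ∑ s, ρ s * ∑ a, σ 0 s a *
      (M.reward s a + M.discount * M.value (M.trans s a) (Fin.tail σ)) := by
  rw [← sum_initial_action, MDP.value, sum_fin_succ_fun]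
  refine Finset.sum_congr rfl fun x _ => ?_
  have h : M.discount * M.value (M.trans x.1 x.2) (Fin.tail σ) =
      ∑ τ, M.trajProb (M.trans x.1 x.2) (Fin.tail σ) τ *
        (M.discount * ∑ t : Fin n, M.discount ^ (t : ℕ) * M.reward (τ t).1 (τ t).2) := by
    rw [MDP.value, Finset.mul_sum]
    exact Finset.sum_congr rfl fun τ _ => by ring
  have h' : M.reward x.1 x.2 =
      ∑ τ, M.trajProb (M.trans x.1 x.2) (Fin.tail σ) τ * M.reward x.1 x.2 := by
    rw [← Finset.sum_mul, M.sum_trajProb, one_mul]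
  rw [h, h', ← Finset.sum_add_distrib, Finset.mul_sum]
  refine Finset.sum_congr rfl fun τ _ => ?_
  rw [M.trajProb_cons, Fin.sum_univ_succ]
  simp only [Fin.cons_zero, Fin.cons_succ, Fin.val_zero, Fin.val_succ, pow_zero, pow_succ',
    Finset.mul_sum]
  simp only [mul_add, Finset.mul_sum]
  congr 1
  · ring
  · exact Finset.sum_congr rfl fun t _ => by ring

theorem MDP.expectedReward_zero (M : MDP S A) (ρ : stdSimplex ℝ S) (π : Policy S A) :
    M.expectedReward ρ π 0 = ∑ s, ρ s * ∑ a, π s a * M.reward s a := by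
  rw [← sum_initial_action, MDP.expectedReward, sum_fin_succ_fun]
  refine Finset.sum_congr rfl fun x _ => ?_
  simp [MDP.trajProb]

theorem MDP.expectedReward_succ (M : MDP S A) (ρ : stdSimplex ℝ S) (π : Policy S A) (t : ℕ) :
    M.expectedReward ρ π (t + 1) =
      ∑ s, ρ s * ∑ a, π s a * M.expectedReward (M.trans s a) π t := by
  rw [← sum_initial_action, MDP.expectedReward, sum_fin_succ_fun]
  refine Finset.sum_congr rfl fun x _ => ?_
  rw [MDP.expectedReward, Finset.mul_sum]
  refine Finset.sum_congr rfl fun τ _ => ?_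
  rw [M.trajProb_cons, ← Fin.succ_last, Fin.cons_succ, mul_assoc]
  rfl

theorem stdSimplex.abs_sum_mul_le {X : Type*} [Fintype X] (w : stdSimplex ℝ X) {f : X → ℝ} {b : ℝ}
    (hf : ∀ x, |f x| ≤ b) : |∑ x, w x * f x| ≤ b := by
  calc |∑ x, w x * f x| ≤ ∑ x, |w x * f x| := Finset.abs_sum_le_sum_abs _ _
    _ ≤ ∑ x, w x * b := Finset.sum_le_sum fun x _ => by
        rw [abs_mul, abs_of_nonneg (stdSimplex.zero_le w x)]
        exact mul_le_mul_of_nonneg_left (hf x) (stdSimplex.zero_le w x)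
    _ = b := by rw [← Finset.sum_mul, stdSimplex.sum_eq_one, one_mul]

theorem stdSimplex.sum_mul_le {X : Type*} [Fintype X] (w : stdSimplex ℝ X) {f : X → ℝ} {b : ℝ}
    (hf : ∀ x, f x ≤ b) : ∑ x, w x * f x ≤ b := by
  calc ∑ x, w x * f x ≤ ∑ x, w x * b := Finset.sum_le_sum fun x _ =>
        mul_le_mul_of_nonneg_left (hf x) (stdSimplex.zero_le w x)
    _ = b := by rw [← Finset.sum_mul, stdSimplex.sum_eq_one, one_mul]

theorem stdSimplex.sum_vertex_mul {X : Type*} [Fintype X] [DecidableEq X] (x : X) (f : X → ℝ) :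
    ∑ y, stdSimplex.vertex (S := ℝ) x y * f y = f x := by
  simp [stdSimplex.vertex, Pi.single_apply]

theorem MDP.abs_expectedReward_le (M : MDP S A) {R : ℝ} (hr : ∀ s a, |M.reward s a| ≤ R)
    (π : Policy S A) (t : ℕ) (ρ : stdSimplex ℝ S) : |M.expectedReward ρ π t| ≤ R := by
  induction t generalizing ρ with
  | zero =>
    rw [M.expectedReward_zero]
    exact stdSimplex.abs_sum_mul_le ρ fun s => stdSimplex.abs_sum_mul_le (π s) (hr s)
  | succ t ih =>
    rw [M.expectedReward_succ]
    exact stdSimplex.abs_sum_mul_le ρ fun s => stdSimplex.abs_sum_mul_le (π s) fun a => ih _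

theorem MDP.summable_expectedReward (M : MDP S A) {R : ℝ} (hr : ∀ s a, |M.reward s a| ≤ R)
    (π : Policy S A) (ρ : stdSimplex ℝ S) :
    Summable fun t => M.discount ^ t * M.expectedReward ρ π t := by
  refine Summable.of_norm_bounded
    ((summable_geometric_of_lt_one M.discount_pos.le M.discount_lt_one).mul_right R) fun t => ?_
  rw [norm_mul, Real.norm_eq_abs, Real.norm_eq_abs,
    abs_of_nonneg (pow_nonneg M.discount_pos.le t)]
  exact mul_le_mul_of_nonneg_left (M.abs_expectedReward_le hr π t ρ)
    (pow_nonneg M.discount_pos.le t)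

theorem MDP.valueInf_eq (M : MDP S A) {R : ℝ} (hr : ∀ s a, |M.reward s a| ≤ R)
    (π : Policy S A) (ρ : stdSimplex ℝ S) :
    M.valueInf ρ π = ∑ s, ρ s * ∑ a, π s a *
      (M.reward s a + M.discount * M.valueInf (M.trans s a) π) := by
  have hs := fun ρ => M.summable_expectedReward hr π ρ
  have key : HasSum (fun t => M.discount ^ (t + 1) * M.expectedReward ρ π (t + 1))
      (∑ s, ρ s * ∑ a, π s a * (M.discount * M.valueInf (M.trans s a) π)) := by
    have h : HasSum (fun t => ∑ s, ρ s * ∑ a, π s a *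
        (M.discount * (M.discount ^ t * M.expectedReward (M.trans s a) π t)))
        (∑ s, ρ s * ∑ a, π s a * (M.discount * M.valueInf (M.trans s a) π)) :=
      hasSum_sum fun s _ => (hasSum_sum fun a _ =>
        ((hs (M.trans s a)).hasSum.mul_left _).mul_left _).mul_left _
    convert h using 2 with t
    rw [M.expectedReward_succ, Finset.mul_sum]
    refine Finset.sum_congr rfl fun s _ => ?_
    rw [mul_left_comm, Finset.mul_sum]
    congr 1
    exact Finset.sum_congr rfl fun a _ => by ring
  rw [MDP.valueInf, (hs ρ).tsum_eq_zero_add, key.tsum_eq, M.expectedReward_zero, pow_zero, one_mul,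
    ← Finset.sum_add_distrib]
  simp only [← mul_add, ← Finset.sum_add_distrib]

theorem MDP.abs_valueInf_le (M : MDP S A) {R : ℝ} (hr : ∀ s a, |M.reward s a| ≤ R)
    (π : Policy S A) (ρ : stdSimplex ℝ S) : |M.valueInf ρ π| ≤ R / (1 - M.discount) := by
  have h := (hasSum_geometric_of_lt_one M.discount_pos.le M.discount_lt_one).mul_right R
  rw [mul_comm, ← div_eq_mul_inv] at h
  rw [← Real.norm_eq_abs]
  refine tsum_of_norm_bounded h fun t => ?_
  rw [norm_mul, Real.norm_eq_abs, Real.norm_eq_abs,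
    abs_of_nonneg (pow_nonneg M.discount_pos.le t)]
  exact mul_le_mul_of_nonneg_left (M.abs_expectedReward_le hr π t ρ)
    (pow_nonneg M.discount_pos.le t)

end Trajectories

/-! ### Softmax gradient ascent on a bandit -/

section Bandit

variable {A : Type*} [Fintype A]

/-- The action itself drops out of its own advantage, which is thus at most `2b(1 - w a)`; and `w(1
- w) ≤ 1/4`. -/
theorem abs_mul_sub_mean_le {w q : A → ℝ} {b : ℝ} (hw : ∀ a, 0 ≤ w a) (hw1 : ∑ a, w a = 1)
    (hq : ∀ a, |q a| ≤ b) (a : A) : |w a * (q a - ∑ a', w a' * q a')| ≤ b / 2 := by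
  classical
  have hb : 0 ≤ b := (abs_nonneg _).trans (hq a)
  have h1 : q a - ∑ a', w a' * q a' = ∑ a' ∈ Finset.univ.erase a, w a' * (q a - q a') := by
    have h : q a = ∑ a', w a' * q a := by rw [← Finset.sum_mul, hw1, one_mul]
    rw [Finset.sum_erase _ (by simp)]
    simp only [mul_sub, Finset.sum_sub_distrib]
    rw [← h]
  have h2 : ∑ a' ∈ Finset.univ.erase a, w a' = 1 - w a := by
    rw [← hw1, ← Finset.add_sum_erase _ _ (Finset.mem_univ a)]; ring
  have h3 : |q a - ∑ a', w a' * q a'| ≤ (1 - w a) * (2 * b) := by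
    rw [h1, ← h2, Finset.sum_mul]
    refine (Finset.abs_sum_le_sum_abs _ _).trans (Finset.sum_le_sum fun a' _ => ?_)
    rw [abs_mul, abs_of_nonneg (hw a')]
    refine mul_le_mul_of_nonneg_left ?_ (hw a')
    have := abs_sub (q a) (q a')
    linarith [hq a, hq a']
  rw [abs_mul, abs_of_nonneg (hw a)]
  refine (mul_le_mul_of_nonneg_left h3 (hw a)).trans ?_
  nlinarith [mul_nonneg hb (sq_nonneg (1 - 2 * w a))]

/-- As `u` and `d` agree in sign, only `exp u ≥ 1 + u` for `d ≥ 0` and an upper bound on `exp u` for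
`u ≤ 0` are needed. The latter loses the factor 7/8 on `[-1/4, 0]`. -/
theorem exp_mul_ge {u d : ℝ} (hu : |u| ≤ 1 / 4) (hud : 0 ≤ u * d) :
    d + 7 / 8 * (u * d) ≤ Real.exp u * d := by
  have h1 : 1 + u ≤ Real.exp u := by linarith [Real.add_one_le_exp u]
  rw [abs_le] at hu
  rcases le_or_gt 0 d with hd | hd
  · nlinarith [mul_le_mul_of_nonneg_right h1 hd]
  · have hu0 : u ≤ 0 := by
      by_contra h
      nlinarith [mul_neg_of_pos_of_neg (not_le.1 h) hd]
    have h2 : Real.exp u ≤ 1 + 7 / 8 * u := by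
      have h3 := Real.quadratic_le_exp_of_nonneg (x := -u) (by linarith)
      have h4 : Real.exp u * Real.exp (-u) = 1 := by rw [← Real.exp_add]; simp
      have h5 : 1 ≤ (1 + 7 / 8 * u) * (1 + -u + (-u) ^ 2 / 2) := by nlinarith
      have h6 : 0 < 1 + 7 / 8 * u := by linarith
      have h7 : (1 + 7 / 8 * u) * (1 + -u + (-u) ^ 2 / 2) ≤ (1 + 7 / 8 * u) * Real.exp (-u) :=
        mul_le_mul_of_nonneg_left h3 h6.le
      have h8 := Real.exp_pos (-u)
      nlinarith
    nlinarith [mul_le_mul_of_nonpos_right h2 hd.le]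

/-- The exponential-weights update increases the mean by at least half of the first-order
prediction. -/
theorem mean_exp_weights_ge {w q u : A → ℝ} (hw : ∀ a, 0 < w a) (hw1 : ∑ a, w a = 1)
    (hu : ∀ a, |u a| ≤ 1 / 4) (hud : ∀ a, 0 ≤ u a * (q a - ∑ a', w a' * q a')) :
    ∑ a, w a * q a + (1 / 2) * ∑ a, w a * (u a * (q a - ∑ a', w a' * q a')) ≤
      ∑ a, w a * Real.exp (u a) / (∑ a', w a' * Real.exp (u a')) * q a := by
  set v := ∑ a, w a * q a with hv
  set Z := ∑ a, w a * Real.exp (u a) with hZ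
  have hne : (Finset.univ : Finset A).Nonempty := by
    rw [Finset.nonempty_iff_ne_empty]
    rintro h
    simp [h] at hw1
  have hZ0 : 0 < Z := Finset.sum_pos (fun a _ => mul_pos (hw a) (Real.exp_pos _)) hne
  -- Chosen so that the factor 7/8 from `exp_mul_ge` divided by 7/4 is the claimed 1/2.
  have hZ1 : Z ≤ 7 / 4 := by
    have h : ∀ a, Real.exp (u a) ≤ 7 / 4 := fun a => by
      have h0 := abs_le.1 (hu a)
      have h1 := Real.add_one_le_exp (-u a)
      have h2 : Real.exp (u a) * Real.exp (-u a) = 1 := by rw [← Real.exp_add]; simp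
      have h3 := Real.exp_pos (u a)
      nlinarith
    calc Z ≤ ∑ a, w a * (7 / 4) :=
          Finset.sum_le_sum fun a _ => mul_le_mul_of_nonneg_left (h a) (hw a).le
      _ = 7 / 4 := by rw [← Finset.sum_mul, hw1, one_mul]
  set D := ∑ a, w a * (u a * (q a - v)) with hD
  have hD0 : 0 ≤ D := Finset.sum_nonneg fun a _ => mul_nonneg (hw a).le (hud a)
  have h0 : ∑ a, w a * (q a - v) = 0 := by
    simp only [mul_sub, Finset.sum_sub_distrib, ← Finset.sum_mul, hw1]
    rw [← hv]; ring
  have h1 : 7 / 8 * D ≤ ∑ a, w a * (Real.exp (u a) * (q a - v)) := by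
    calc 7 / 8 * D = ∑ a, w a * ((q a - v) + 7 / 8 * (u a * (q a - v))) := by
          simp only [mul_add, Finset.sum_add_distrib, h0, zero_add, hD, Finset.mul_sum]
          exact Finset.sum_congr rfl fun a _ => by ring
      _ ≤ _ := Finset.sum_le_sum fun a _ =>
          mul_le_mul_of_nonneg_left (exp_mul_ge (hu a) (hud a)) (hw a).le
  have h2 : ∑ a, w a * (Real.exp (u a) * (q a - v)) = ∑ a, w a * Real.exp (u a) * q a - Z * v := by
    rw [hZ, Finset.sum_mul, ← Finset.sum_sub_distrib]
    exact Finset.sum_congr rfl fun a _ => by ring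
  have h3 : ∑ a, w a * Real.exp (u a) / Z * q a = (∑ a, w a * Real.exp (u a) * q a) / Z := by
    rw [Finset.sum_div]
    exact Finset.sum_congr rfl fun a _ => by ring
  rw [h3, le_div_iff₀ hZ0]
  nlinarith [mul_nonneg hD0 (sub_nonneg.2 hZ1)]

/-- Induction step from the recursion to the `1/n` rate. The map `x ↦ x - x²/C` is not monotone
beyond `C/2`, hence the case split: either `x` is already below the new bound, or `1 - x/C` is
small. -/
theorem sub_sq_div_le {C x : ℝ} (hC : 0 < C) (n : ℕ) (hx0 : 0 ≤ x)
    (hx : x ≤ C / (n + 1)) : x - x ^ 2 / C ≤ C / (n + 2) := by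
  rcases le_or_gt x (C / (n + 2)) with h | h
  · have : 0 ≤ x ^ 2 / C := by positivity
    linarith
  · have h1 : x - x ^ 2 / C = x * (1 - x / C) := by ring
    have h2 : 1 - x / C ≤ 1 - 1 / ((n : ℝ) + 2) := by
      have : 1 / ((n : ℝ) + 2) ≤ x / C := by
        rw [le_div_iff₀ hC]
        calc 1 / ((n : ℝ) + 2) * C = C / (n + 2) := by ring
          _ ≤ x := h.le
      linarith
    rw [h1]
    have h3 : 0 ≤ 1 - 1 / ((n : ℝ) + 2) := by
      rw [sub_nonneg, div_le_one (by positivity)]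
      linarith [(Nat.cast_nonneg n : (0 : ℝ) ≤ n)]
    calc x * (1 - x / C) ≤ x * (1 - 1 / ((n : ℝ) + 2)) := mul_le_mul_of_nonneg_left h2 hx0
      _ ≤ C / (n + 1) * (1 - 1 / ((n : ℝ) + 2)) := mul_le_mul_of_nonneg_right hx h3
      _ = C / (n + 2) := by field_simp; ring

/-- Softmax policy gradient ascent on a bandit with mean rewards `q`, started in the uniform
policy, converges at rate `1 / n`. -/
theorem softmax_bandit_error_le [Nonempty A] {q : A → ℝ} {b α : ℝ} (hα : 0 < α)
    (hαb : 2 * b * α ≤ 1) (hq : ∀ a, |q a| ≤ b) {θ p : ℕ → A → ℝ}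
    (hp : ∀ n a, p n a = Real.exp (θ n a) / ∑ a', Real.exp (θ n a'))
    (h0 : ∀ a a', θ 0 a = θ 0 a')
    (hθ : ∀ n a, θ (n + 1) a = θ n a + α * (p n a * (q a - ∑ a', p n a' * q a')))
    (n : ℕ) (a : A) :
    q a - ∑ a', p n a' * q a' ≤ 2 * (Fintype.card A : ℝ) ^ 2 / (α * (n + 1)) := by
  obtain ⟨a₀, ha₀⟩ := Finite.exists_max q
  refine (sub_le_sub_right (ha₀ a) _).trans ?_
  have hZ : ∀ n, 0 < ∑ a', Real.exp (θ n a') := fun n =>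
    Finset.sum_pos (fun a _ => Real.exp_pos _) Finset.univ_nonempty
  have hp0 : ∀ n a, 0 < p n a := fun n a => by
    rw [hp]; exact div_pos (Real.exp_pos _) (hZ n)
  have hp1 : ∀ n, ∑ a, p n a = 1 := fun n => by
    simp only [hp, ← Finset.sum_div]; exact div_self (hZ n).ne'
  have hv : ∀ n, ∑ a', p n a' * q a' ≤ q a₀ := fun n => by
    calc ∑ a', p n a' * q a' ≤ ∑ a', p n a' * q a₀ :=
          Finset.sum_le_sum fun a _ => mul_le_mul_of_nonneg_left (ha₀ a) (hp0 n a).le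
      _ = q a₀ := by rw [← Finset.sum_mul, hp1, one_mul]
  -- The largest logit stays at the best action: it has both the largest probability and the
  -- largest, nonnegative advantage, hence the largest increment.
  have hmax : ∀ n a, θ n a ≤ θ n a₀ := by
    intro n
    induction n with
    | zero => exact fun a => (h0 a a₀).le
    | succ n ih =>
      intro a
      rw [hθ, hθ]
      have hpa : p n a ≤ p n a₀ := by
        rw [hp, hp]
        exact div_le_div_of_nonneg_right (Real.exp_le_exp.2 (ih a)) (hZ n).le
      have h1 : p n a * (q a - ∑ a', p n a' * q a') ≤ p n a₀ * (q a₀ - ∑ a', p n a' * q a') :=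
        (mul_le_mul_of_nonneg_left (sub_le_sub_right (ha₀ a) _) (hp0 n a).le).trans
          (mul_le_mul_of_nonneg_right hpa (sub_nonneg.2 (hv n)))
      linarith [ih a, mul_le_mul_of_nonneg_left h1 hα.le]
  set K : ℝ := (Fintype.card A : ℝ) with hK
  have hK1 : 1 ≤ K := by
    rw [hK]; exact_mod_cast Fintype.card_pos
  have hpK : ∀ n, 1 / K ≤ p n a₀ := fun n => by
    rw [hp, div_le_div_iff₀ (by linarith) (hZ n), one_mul]
    calc ∑ a', Real.exp (θ n a') ≤ ∑ _a' : A, Real.exp (θ n a₀) :=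
          Finset.sum_le_sum fun a _ => Real.exp_le_exp.2 (hmax n a)
      _ = Real.exp (θ n a₀) * K := by simp [hK, mul_comm]
  have hstep : ∀ n, ∑ a', p n a' * q a' + (1 / 2) *
      (α * (q a₀ - ∑ a', p n a' * q a') ^ 2 / K ^ 2) ≤ ∑ a', p (n + 1) a' * q a' := by
    intro n
    set v := ∑ a', p n a' * q a' with hvdef
    have hu : ∀ a, |α * (p n a * (q a - v))| ≤ 1 / 4 := fun a => by
      rw [abs_mul, abs_of_pos hα]
      nlinarith [abs_mul_sub_mean_le (fun a => (hp0 n a).le) (hp1 n) hq a]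
    have hud : ∀ a, 0 ≤ α * (p n a * (q a - v)) * (q a - v) := fun a => by
      have := mul_nonneg (mul_nonneg hα.le (hp0 n a).le) (sq_nonneg (q a - v))
      linarith
    have h := mean_exp_weights_ge (hp0 n) (hp1 n) hu hud
    have hnext : ∀ a, p (n + 1) a = p n a * Real.exp (α * (p n a * (q a - v))) /
        ∑ a', p n a' * Real.exp (α * (p n a' * (q a' - v))) := fun a => by
      have h1 : ∀ a, p n a * Real.exp (α * (p n a * (q a - v))) =
          Real.exp (θ (n + 1) a) / ∑ a', Real.exp (θ n a') := fun a => by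
        rw [hθ, Real.exp_add, ← hvdef, mul_div_right_comm, ← hp]
      simp only [h1]
      rw [← Finset.sum_div, div_div_div_cancel_right₀ (hZ n).ne', hp]
    simp only [← hnext] at h
    refine le_trans ?_ h
    -- All terms are nonnegative; keeping only the best action, with `p n a₀ ≥ 1/K`, produces the
    -- factor `1/K²`.
    have h2 : α * (q a₀ - v) ^ 2 / K ^ 2 ≤ ∑ a, p n a * (α * (p n a * (q a - v)) * (q a - v)) := by
      calc α * (q a₀ - v) ^ 2 / K ^ 2 = α * (q a₀ - v) ^ 2 * (1 / K) ^ 2 := by ring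
        _ ≤ α * (q a₀ - v) ^ 2 * (p n a₀) ^ 2 := by
            gcongr
            exact hpK n
        _ = p n a₀ * (α * (p n a₀ * (q a₀ - v)) * (q a₀ - v)) := by ring
        _ ≤ _ := Finset.single_le_sum
            (f := fun a => p n a * (α * (p n a * (q a - v)) * (q a - v)))
            (fun a _ => mul_nonneg (hp0 n a).le (hud a)) (Finset.mem_univ a₀)
    linarith
  have hC : 0 < 2 * K ^ 2 / α := by positivity
  have main : ∀ n : ℕ, q a₀ - ∑ a', p n a' * q a' ≤ 2 * K ^ 2 / α / (n + 1) := by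
    intro n
    induction n with
    | zero =>
      have h1 : -b ≤ ∑ a', p 0 a' * q a' := by
        calc -b = ∑ a', p 0 a' * (-b) := by rw [← Finset.sum_mul, hp1, one_mul]
          _ ≤ _ := Finset.sum_le_sum fun a _ =>
            mul_le_mul_of_nonneg_left (abs_le.1 (hq a)).1 (hp0 0 a).le
      have h2 := (abs_le.1 (hq a₀)).2
      have h3 : 2 * b ≤ 2 * K ^ 2 / α := by
        rw [le_div_iff₀ hα]; nlinarith
      simp only [Nat.cast_zero, zero_add, div_one]
      linarith
    | succ n ih =>
      have h1 := sub_sq_div_le hC n (sub_nonneg.2 (hv n)) ih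
      have h2 := hstep n
      have h3 : (q a₀ - ∑ a', p n a' * q a') ^ 2 / (2 * K ^ 2 / α) =
          1 / 2 * (α * (q a₀ - ∑ a', p n a' * q a') ^ 2 / K ^ 2) := by
        field_simp
      have h4 : ((n + 1 : ℕ) : ℝ) + 1 = n + 2 := by push_cast; ring
      rw [h4]
      linarith
  refine (main n).trans_eq ?_
  rw [div_div]

end Bandit

/-! ### The softmax policy gradient -/

section Gradient

variable {S A : Type*} [Fintype S] [Fintype A] [Nonempty A]

theorem hasGradientAt_sum_softmax (μ : S → ℝ) (q : S → A → ℝ) (θ : EuclideanSpace ℝ (S × A)) :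
    HasGradientAt (fun θ => ∑ s, μ s * ∑ a, softmaxPolicy θ s a * q s a)
      (WithLp.toLp 2 fun x : S × A => μ x.1 * (softmaxPolicy θ x.1 x.2 *
        (q x.1 x.2 - ∑ a, softmaxPolicy θ x.1 a * q x.1 a))) θ := by
  rw [hasGradientAt_iff_hasFDerivAt]
  have he : ∀ s a, HasFDerivAt (fun θ : EuclideanSpace ℝ (S × A) => Real.exp (θ (s, a)))
      (Real.exp (θ (s, a)) • (EuclideanSpace.proj (s, a) : EuclideanSpace ℝ (S × A) →L[ℝ] ℝ)) θ :=
    fun s a => (EuclideanSpace.proj (s, a) : EuclideanSpace ℝ (S × A) →L[ℝ] ℝ).hasFDerivAt.exp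
  have hZ : ∀ s, 0 < ∑ a', Real.exp (θ (s, a')) := fun s =>
    Finset.sum_pos (fun a _ => Real.exp_pos _) Finset.univ_nonempty
  have hd := HasFDerivAt.fun_sum (u := Finset.univ) fun s (_ : s ∈ Finset.univ) =>
    ((HasFDerivAt.fun_sum (u := Finset.univ) fun a (_ : a ∈ Finset.univ) =>
      (he s a).mul_const (q s a)).mul
      ((hasDerivAt_inv (hZ s).ne').comp_hasFDerivAt θ
        (HasFDerivAt.fun_sum (u := Finset.univ) fun a (_ : a ∈ Finset.univ) => he s a))).const_mul
        (μ s)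
  have hfun : (fun θ : EuclideanSpace ℝ (S × A) => ∑ s, μ s * ∑ a, softmaxPolicy θ s a * q s a) =
      fun θ => ∑ s, μ s * ((∑ a, Real.exp (θ (s, a)) * q s a) *
        (∑ a, Real.exp (θ (s, a)))⁻¹) := by
    funext θ
    refine Finset.sum_congr rfl fun s _ => ?_
    rw [Finset.sum_mul]
    congr 1
    refine Finset.sum_congr rfl fun a _ => ?_
    change Real.exp (θ (s, a)) / _ * _ = _
    ring
  rw [hfun]
  refine hd.congr_fderiv ?_
  ext v
  rw [InnerProductSpace.toDual_apply_apply, PiLp.inner_apply, Fintype.sum_prod_type,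
    sum_apply]
  refine Finset.sum_congr rfl fun s _ => ?_
  have hsm : ∀ a, softmaxPolicy θ s a = Real.exp (θ (s, a)) / ∑ a', Real.exp (θ (s, a')) :=
    fun a => rfl
  have hmean : ∑ a, softmaxPolicy θ s a * q s a =
      (∑ a, Real.exp (θ (s, a)) * q s a) / ∑ a', Real.exp (θ (s, a')) := by
    rw [Finset.sum_div]
    exact Finset.sum_congr rfl fun a _ => by rw [hsm]; ring
  simp only [smul_apply, add_apply, sum_apply, smul_eq_mul, Function.comp_apply,
    PiLp.proj_apply, RCLike.inner_apply, conj_trivial, hmean]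
  simp only [hsm]
  set Z := ∑ a', Real.exp (θ (s, a')) with hZdef
  set E := ∑ a, Real.exp (θ (s, a)) * q s a
  have hZ0 := (hZ s).ne'
  rw [← hZdef] at hZ0
  have hterm : ∀ a, v (s, a) * (μ s * (Real.exp (θ (s, a)) / Z * (q s a - E / Z))) =
      μ s * Z⁻¹ * (q s a * (Real.exp (θ (s, a)) * v (s, a))) -
        μ s * E * (Z ^ 2)⁻¹ * (Real.exp (θ (s, a)) * v (s, a)) := fun a => by
    field_simp
  simp only [hterm, Finset.sum_sub_distrib, ← Finset.mul_sum]
  ring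

end Gradient

/-! ### Bellman operators, optimality and error propagation -/

section Bellman

variable {S A : Type*} [Fintype S]

/-- The state-action value `r(s, a) + γ ∑ p(s' | s, a) V(s')` of a value function `V`. -/
noncomputable def MDP.qValue (M : MDP S A) (V : S → ℝ) (s : S) (a : A) : ℝ :=
  M.reward s a + M.discount * ∑ s', M.trans s a s' * V s'

theorem MDP.qValue_le_add (M : MDP S A) {V W : S → ℝ} {D : ℝ} (h : ∀ s, V s ≤ W s + D)
    (s : S) (a : A) : M.qValue V s a ≤ M.qValue W s a + M.discount * D := by
  have h1 : ∑ s', M.trans s a s' * V s' - ∑ s', M.trans s a s' * W s' ≤ D := by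
    rw [← Finset.sum_sub_distrib]
    simp only [← mul_sub]
    exact stdSimplex.sum_mul_le _ fun s' => by linarith [h s']
  have h2 := mul_le_mul_of_nonneg_left h1 M.discount_pos.le
  rw [MDP.qValue, MDP.qValue]
  linarith

theorem MDP.abs_qValue_le (M : MDP S A) {R b : ℝ} (hr : ∀ s a, |M.reward s a| ≤ R) {V : S → ℝ}
    (hV : ∀ s, |V s| ≤ b) (s : S) (a : A) : |M.qValue V s a| ≤ R + M.discount * b := by
  refine (abs_add_le _ _).trans (add_le_add (hr s a) ?_)
  rw [abs_mul, abs_of_pos M.discount_pos]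
  exact mul_le_mul_of_nonneg_left (stdSimplex.abs_sum_mul_le _ hV) M.discount_pos.le

variable [Fintype A]

/-- The Bellman expectation operator of the policy `π`. -/
noncomputable def MDP.bellman (M : MDP S A) (π : Policy S A) (V : S → ℝ) (s : S) : ℝ :=
  ∑ a, π s a * M.qValue V s a

/-- The Bellman optimality operator. -/
noncomputable def MDP.bellmanOpt [Nonempty A] (M : MDP S A) (V : S → ℝ) (s : S) : ℝ :=
  Finset.univ.sup' Finset.univ_nonempty (M.qValue V s)

theorem MDP.bellman_le_add (M : MDP S A) (π : Policy S A) {V W : S → ℝ} {D : ℝ}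
    (h : ∀ s, V s ≤ W s + D) (s : S) : M.bellman π V s ≤ M.bellman π W s + M.discount * D := by
  have h1 : M.bellman π V s - M.bellman π W s ≤ M.discount * D := by
    rw [MDP.bellman, MDP.bellman, ← Finset.sum_sub_distrib]
    simp only [← mul_sub]
    exact stdSimplex.sum_mul_le _ fun a => by linarith [M.qValue_le_add h s a]
  linarith

section Optimality

variable [Nonempty A]

theorem MDP.qValue_le_bellmanOpt (M : MDP S A) (V : S → ℝ) (s : S) (a : A) :
    M.qValue V s a ≤ M.bellmanOpt V s :=
  Finset.le_sup' (M.qValue V s) (Finset.mem_univ a)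

theorem MDP.bellman_le_bellmanOpt (M : MDP S A) (π : Policy S A) (V : S → ℝ) (s : S) :
    M.bellman π V s ≤ M.bellmanOpt V s :=
  stdSimplex.sum_mul_le _ (M.qValue_le_bellmanOpt V s)

theorem MDP.bellmanOpt_le_add (M : MDP S A) {V W : S → ℝ} {D : ℝ} (h : ∀ s, V s ≤ W s + D)
    (s : S) : M.bellmanOpt V s ≤ M.bellmanOpt W s + M.discount * D :=
  Finset.sup'_le _ _ fun a _ => (M.qValue_le_add h s a).trans
    (add_le_add_left (M.qValue_le_bellmanOpt W s a) _)

/-- A greedy policy attains the Bellman optimality operator. -/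
theorem MDP.exists_bellman_eq_bellmanOpt (M : MDP S A) (V : S → ℝ) :
    ∃ π : Policy S A, M.bellman π V = M.bellmanOpt V := by
  classical
  choose a ha using fun s => Finite.exists_max (M.qValue V s)
  refine ⟨fun s => stdSimplex.vertex (a s), funext fun s => ?_⟩
  rw [MDP.bellman, stdSimplex.sum_vertex_mul]
  exact le_antisymm (M.qValue_le_bellmanOpt V s (a s)) (Finset.sup'_le _ _ fun b _ => ha s b)

theorem MDP.exists_bellmanOpt_fixedPoint (M : MDP S A) : ∃ W : S → ℝ, M.bellmanOpt W = W := by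
  have hc : ContractingWith ⟨M.discount, M.discount_pos.le⟩ M.bellmanOpt := by
    refine ⟨by exact_mod_cast M.discount_lt_one, LipschitzWith.of_dist_le_mul fun V W => ?_⟩
    change dist _ _ ≤ M.discount * dist V W
    have hVW : ∀ s, |V s - W s| ≤ dist V W := fun s => by
      rw [← Real.dist_eq]; exact dist_le_pi_dist V W s
    rw [dist_pi_le_iff (mul_nonneg M.discount_pos.le dist_nonneg)]
    intro s
    have h1 := M.bellmanOpt_le_add (V := V) (W := W) (D := dist V W)
      (fun s => by linarith [(abs_le.1 (hVW s)).2]) s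
    have h2 := M.bellmanOpt_le_add (V := W) (W := V) (D := dist V W)
      (fun s => by linarith [(abs_le.1 (hVW s)).1]) s
    rw [Real.dist_eq, abs_le]
    constructor <;> linarith
  exact ⟨_, hc.fixedPoint_isFixedPt⟩

end Optimality

/-- A function whose upper bounds improve by a contraction is bounded by the fixed point of this
contraction. -/
theorem le_div_of_improves {X : Type*} [Finite X] {f : X → ℝ} {g c : ℝ} (hg : g < 1)
    (h : ∀ D, (∀ x, f x ≤ D) → ∀ x, f x ≤ g * D + c) (x : X) : f x ≤ c / (1 - g) := by
  have : Nonempty X := ⟨x⟩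
  obtain ⟨y, hy⟩ := Finite.exists_max f
  have h1 := h (f y) hy y
  refine (hy x).trans ?_
  rw [le_div_iff₀ (by linarith)]
  linarith

section Values

variable [DecidableEq S]

theorem MDP.valueInf_eq_bellman (M : MDP S A) {R : ℝ} (hr : ∀ s a, |M.reward s a| ≤ R)
    (π : Policy S A) : (fun s => M.valueInf (stdSimplex.vertex s) π) =
      M.bellman π fun s => M.valueInf (stdSimplex.vertex s) π := by
  have hlin : ∀ ρ : stdSimplex ℝ S, M.valueInf ρ π =
      ∑ s, ρ s * M.valueInf (stdSimplex.vertex s) π := fun ρ => by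
    rw [M.valueInf_eq hr]
    refine Finset.sum_congr rfl fun s _ => ?_
    rw [M.valueInf_eq hr π (stdSimplex.vertex s), stdSimplex.sum_vertex_mul]
  funext s
  rw [M.valueInf_eq hr, stdSimplex.sum_vertex_mul]
  refine Finset.sum_congr rfl fun a _ => ?_
  rw [hlin (M.trans s a), MDP.qValue]

theorem MDP.value_eq_sum (M : MDP S A) {n : ℕ} (ρ : stdSimplex ℝ S)
    (σ : Fin n → Policy S A) : M.value ρ σ = ∑ s, ρ s * M.value (stdSimplex.vertex s) σ := by
  cases n with
  | zero => simp [M.value_zero]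
  | succ n =>
    rw [M.value_succ]
    refine Finset.sum_congr rfl fun s _ => ?_
    rw [M.value_succ (stdSimplex.vertex s), stdSimplex.sum_vertex_mul]

theorem MDP.value_cons (M : MDP S A) {n : ℕ} (ρ : stdSimplex ℝ S) (π : Policy S A)
    (σ : Fin n → Policy S A) : M.value ρ (Fin.cons π σ) =
      ∑ s, ρ s * M.bellman π (fun s => M.value (stdSimplex.vertex s) σ) s := by
  rw [M.value_succ]
  refine Finset.sum_congr rfl fun s _ => ?_
  congr 1
  refine Finset.sum_congr rfl fun a _ => ?_
  rw [Fin.tail_cons, M.value_eq_sum (M.trans s a), MDP.qValue, Fin.cons_zero]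

theorem MDP.value_vertex_cons (M : MDP S A) {n : ℕ} (π : Policy S A)
    (σ : Fin n → Policy S A) : (fun s => M.value (stdSimplex.vertex s) (Fin.cons π σ)) =
      M.bellman π fun s => M.value (stdSimplex.vertex s) σ := by
  funext s
  rw [M.value_cons, stdSimplex.sum_vertex_mul]

theorem MDP.abs_value_le (M : MDP S A) {R : ℝ} (hr : ∀ s a, |M.reward s a| ≤ R) {n : ℕ}
    (σ : Fin n → Policy S A) (ρ : stdSimplex ℝ S) :
    |M.value ρ σ| ≤ R * (1 - M.discount ^ n) / (1 - M.discount) := by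
  have h1 : 1 - M.discount ≠ 0 := (sub_pos.2 M.discount_lt_one).ne'
  induction n generalizing ρ with
  | zero => simp [M.value_zero]
  | succ n ih =>
    rw [← Fin.cons_self_tail σ, M.value_cons]
    refine stdSimplex.abs_sum_mul_le _ fun s => stdSimplex.abs_sum_mul_le _ fun a =>
      (M.abs_qValue_le hr (fun s => ih (Fin.tail σ) (stdSimplex.vertex s)) s a).trans_eq ?_
    field_simp
    ring

theorem MDP.valueInf_le_optValue (M : MDP S A) {R : ℝ} (hr : ∀ s a, |M.reward s a| ≤ R)
    (π : Policy S A) (s : S) :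
    M.valueInf (stdSimplex.vertex s) π ≤ M.optValue (stdSimplex.vertex s) :=
  le_ciSup (f := fun π => M.valueInf (stdSimplex.vertex s) π)
    ⟨R / (1 - M.discount), by rintro _ ⟨π, rfl⟩; exact le_of_abs_le (M.abs_valueInf_le hr π _)⟩ π

variable [Nonempty A]

/-- The optimal value function is the fixed point of the Bellman optimality operator. -/
theorem MDP.bellmanOpt_optValue (M : MDP S A) {R : ℝ} (hr : ∀ s a, |M.reward s a| ≤ R) :
    (M.bellmanOpt fun s => M.optValue (stdSimplex.vertex s)) =
      fun s => M.optValue (stdSimplex.vertex s) := by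
  obtain ⟨W, hW⟩ := M.exists_bellmanOpt_fixedPoint
  -- An upper bound `D` of `V - W` improves to `γ D`, so `V - W ≤ 0`. The reverse inequality below
  -- is the same argument for a policy greedy with respect to `W`.
  have hle : ∀ π s, M.valueInf (stdSimplex.vertex s) π ≤ W s := fun π s => by
    set V := fun s => M.valueInf (stdSimplex.vertex s) π
    have hVb : V = M.bellman π V := M.valueInf_eq_bellman hr π
    have h := le_div_of_improves (f := fun s => V s - W s) (c := 0) M.discount_lt_one
      (fun D hD x => by
        have h1 := M.bellmanOpt_le_add (V := V) (W := W) (D := D)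
          (fun s => by linarith [hD s]) x
        have h2 := M.bellman_le_bellmanOpt π V x
        rw [← hVb] at h2
        rw [hW] at h1
        linarith) s
    rw [zero_div] at h
    exact sub_nonpos.1 h
  obtain ⟨π, hπ⟩ := M.exists_bellman_eq_bellmanOpt W
  have hge : ∀ s, W s ≤ M.valueInf (stdSimplex.vertex s) π := fun s => by
    set V := fun s => M.valueInf (stdSimplex.vertex s) π
    have hVb : V = M.bellman π V := M.valueInf_eq_bellman hr π
    have h := le_div_of_improves (f := fun s => W s - V s) (c := 0) M.discount_lt_one
      (fun D hD x => by
        have h1 := M.bellman_le_add π (V := W) (W := V) (D := D)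
          (fun s => by linarith [hD s]) x
        rw [← hVb, hπ, hW] at h1
        linarith) s
    rw [zero_div] at h
    exact sub_nonpos.1 h
  have : Nonempty (Policy S A) := ⟨π⟩
  have hopt : (fun s => M.optValue (stdSimplex.vertex s)) = W := funext fun s =>
    le_antisymm (ciSup_le fun π => hle π s)
      ((hge s).trans (le_ciSup (f := fun π => M.valueInf (stdSimplex.vertex s) π)
        ⟨W s, by rintro _ ⟨π, rfl⟩; exact hle π s⟩ π))
  rw [hopt, hW]

theorem MDP.abs_optValue_le (M : MDP S A) {R : ℝ} (hr : ∀ s a, |M.reward s a| ≤ R) (s : S) :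
    |M.optValue (stdSimplex.vertex s)| ≤ R / (1 - M.discount) := by
  set W := fun s => M.optValue (stdSimplex.vertex s) with hW
  have hfix : M.bellmanOpt W = W := M.bellmanOpt_optValue hr
  obtain ⟨π, hπ⟩ := M.exists_bellman_eq_bellmanOpt W
  refine le_div_of_improves (f := fun s => |W s|) M.discount_lt_one (fun D hD s => ?_) s
  rw [← hfix, ← hπ]
  exact (stdSimplex.abs_sum_mul_le _ (M.abs_qValue_le hr hD s)).trans_eq (add_comm _ _)

/-- Error propagation: one step of approximate dynamic programming. -/
theorem MDP.abs_optValue_sub_bellman_le (M : MDP S A) {R D e : ℝ}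
    (hr : ∀ s a, |M.reward s a| ≤ R) {V : S → ℝ} {π : Policy S A}
    (hD : ∀ s, |M.optValue (stdSimplex.vertex s) - V s| ≤ D)
    (he : ∀ s a, M.qValue V s a - M.bellman π V s ≤ e) (s : S) :
    |M.optValue (stdSimplex.vertex s) - M.bellman π V s| ≤ M.discount * D + e := by
  set W := fun s => M.optValue (stdSimplex.vertex s) with hW
  have hfix : M.bellmanOpt W = W := M.bellmanOpt_optValue hr
  -- If `e < 0`, every action value would lie strictly below the mean of the action values.
  have he0 : 0 ≤ e := by
    by_contra hlt
    have : M.bellman π V s ≤ M.bellman π V s + e := stdSimplex.sum_mul_le _ fun a => by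
      linarith [he s a]
    linarith
  have h0 : M.bellmanOpt V s ≤ M.bellman π V s + e :=
    Finset.sup'_le _ _ fun a _ => by linarith [he s a]
  have h1 := M.bellmanOpt_le_add (V := W) (W := V) (D := D)
    (fun s => by linarith [(abs_le.1 (hD s)).2]) s
  have h2 := M.bellmanOpt_le_add (V := V) (W := W) (D := D)
    (fun s => by linarith [(abs_le.1 (hD s)).1]) s
  have h3 := M.bellman_le_bellmanOpt π V s
  rw [hfix] at h1 h2
  change |W s - _| ≤ _
  rw [abs_le]
  constructor <;> linarith

/-- A policy that is almost greedy for an approximation of the optimal value function has an almost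
optimal stationary value. -/
theorem MDP.optValue_sub_valueInf_le (M : MDP S A) {R D e : ℝ}
    (hr : ∀ s a, |M.reward s a| ≤ R) {V : S → ℝ} {π : Policy S A}
    (hD : ∀ s, |M.optValue (stdSimplex.vertex s) - V s| ≤ D)
    (he : ∀ s a, M.qValue V s a - M.bellman π V s ≤ e) (s : S) :
    |M.optValue (stdSimplex.vertex s) - M.valueInf (stdSimplex.vertex s) π| ≤
      (2 * M.discount * D + e) / (1 - M.discount) := by
  rw [abs_of_nonneg (sub_nonneg.2 (M.valueInf_le_optValue hr π s))]
  refine le_div_of_improves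
    (f := fun s => M.optValue (stdSimplex.vertex s) - M.valueInf (stdSimplex.vertex s) π)
    M.discount_lt_one (fun D' hD' s => ?_) s
  set U := fun s => M.valueInf (stdSimplex.vertex s) π
  have hUb : U = M.bellman π U := M.valueInf_eq_bellman hr π
  -- Compare through `M.bellman π V`: it is within `γD + e` of the optimum, and at most `γ(D + D')`
  -- above the stationary value.
  have h1 := (abs_le.1 (M.abs_optValue_sub_bellman_le hr hD he s)).2
  have h2 := M.bellman_le_add π (V := V) (W := U) (D := D + D')
    (fun s => by
      have := hD' s
      change _ - U s ≤ _ at this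
      linarith [(abs_le.1 (hD s)).1]) s
  rw [← hUb] at h2
  change _ - U s ≤ _
  linarith

end Values

end Bellman

/-! ### Accuracy of the epochs of DynPG -/

section Epoch

variable {S A : Type*} [Fintype S] [DecidableEq S] [Fintype A] [Nonempty A]

/-- The decoupling: the logits of a state follow a bandit recursion that involves no other state. -/
theorem gradAscent_value_succ (M : MDP S A) (μ : stdSimplex ℝ S) {h : ℕ} (Λ : Fin h → Policy S A)
    (η : ℝ) (θ₀ : EuclideanSpace ℝ (S × A)) (n : ℕ) (s : S) (a : A) :
    let V := fun s => M.value (stdSimplex.vertex s) Λ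
    let θ := gradAscent (fun θ => M.value μ (Fin.cons (softmaxPolicy θ) Λ)) η θ₀
    θ (n + 1) (s, a) = θ n (s, a) + η * μ s * (softmaxPolicy (θ n) s a *
      (M.qValue V s a - ∑ a', softmaxPolicy (θ n) s a' * M.qValue V s a')) := by
  intro V θ
  have hf : (fun θ => M.value μ (Fin.cons (softmaxPolicy θ) Λ)) =
      fun θ => ∑ s, μ s * ∑ a, softmaxPolicy θ s a * M.qValue V s a :=
    funext fun θ => M.value_cons μ (softmaxPolicy θ) Λ
  have hg : ∇ (fun θ => M.value μ (Fin.cons (softmaxPolicy θ) Λ)) (θ n) = WithLp.toLp 2 fun x : S × A => μ x.1 *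
      (softmaxPolicy (θ n) x.1 x.2 * (M.qValue V x.1 x.2 -
        ∑ a, softmaxPolicy (θ n) x.1 a * M.qValue V x.1 a)) := by
    rw [hf]
    exact (hasGradientAt_sum_softmax (fun s => μ s) (M.qValue V) (θ n)).gradient
  change (θ n + η • ∇ (fun θ => M.value μ (Fin.cons (softmaxPolicy θ) Λ)) (θ n)) (s, a) = _
  rw [hg, PiLp.add_apply, PiLp.smul_apply, smul_eq_mul, mul_assoc]

/-- After `stepCount` gradient steps, an epoch of softmax DynPG is greedy up to the tolerance. -/
theorem qValue_sub_bellman_dynPGEpoch_le (M : MDP S A) {R : ℝ} (hR : 0 < R)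
    (hr : ∀ s a, |M.reward s a| ≤ R) (μ : stdSimplex ℝ S) (hμ : ∀ s, 0 < μ s) {h : ℕ}
    (Λ : Fin h → Policy S A) (θ₀ : EuclideanSpace ℝ (S × A))
    (hθ₀ : ∀ s a, softmaxPolicy θ₀ s a = 1 / (Fintype.card A : ℝ)) {e : ℝ} (he : 0 < e) {N : ℕ}
    (hN : stepCount M.discount R ‖fun s : S => 1 / μ s‖ (Fintype.card A) e h ≤ N + 1)
    (s : S) (a : A) :
    M.qValue (fun s => M.value (stdSimplex.vertex s) Λ) s a -
      M.bellman (dynPGEpoch M μ Λ (stepSize M.discount R h) θ₀ N)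
        (fun s => M.value (stdSimplex.vertex s) Λ) s ≤ e := by
  have h1 : 0 < 1 - M.discount := sub_pos.2 M.discount_lt_one
  have h2 : 0 < 1 - M.discount ^ (h + 1) :=
    sub_pos.2 (pow_lt_one₀ M.discount_pos.le M.discount_lt_one h.succ_ne_zero)
  have hs := hμ s
  set V := fun s => M.value (stdSimplex.vertex s) Λ
  set b := R * (1 - M.discount ^ (h + 1)) / (1 - M.discount) with hb
  have hb0 : 0 < b := by positivity
  set η := stepSize M.discount R h with hη
  have hηb : 2 * b * η = 1 := by
    rw [hη, stepSize, hb]; field_simp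
  have hη0 : 0 < η := by
    rw [hη, stepSize]; positivity
  have hq : ∀ a, |M.qValue V s a| ≤ b := fun a =>
    (M.abs_qValue_le hr (fun s => M.abs_value_le hr Λ (stdSimplex.vertex s)) s a).trans_eq (by
      rw [hb]; field_simp; ring)
  -- The weight `μ s ≤ 1` only shrinks the step, so the bandit step condition holds in every state.
  have hα : 2 * b * (η * μ s) ≤ 1 := by
    rw [← mul_assoc, hηb, one_mul]
    exact stdSimplex.le_one μ s
  set θ := gradAscent (fun θ => M.value μ (Fin.cons (softmaxPolicy θ) Λ)) η θ₀ with hθ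
  have hinit : ∀ a a', θ 0 (s, a) = θ 0 (s, a') := fun a a' => by
    have h3 : Real.exp (θ₀ (s, a)) / ∑ a', Real.exp (θ₀ (s, a')) =
        Real.exp (θ₀ (s, a')) / ∑ a', Real.exp (θ₀ (s, a')) :=
      (hθ₀ s a).trans (hθ₀ s a').symm
    rw [div_left_inj'
      (Finset.sum_pos (fun a _ => Real.exp_pos _) Finset.univ_nonempty).ne'] at h3
    exact Real.exp_injective h3
  have key := softmax_bandit_error_le (mul_pos hη0 hs) hα hq
    (θ := fun n a => θ n (s, a)) (p := fun n a => softmaxPolicy (θ n) s a)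
    (fun n a => rfl) hinit (fun n a => gradAscent_value_succ M μ Λ η θ₀ n s a) N a
  refine key.trans ?_
  have hm : 1 / μ s ≤ ‖fun s : S => 1 / μ s‖ :=
    (le_abs_self _).trans (norm_le_pi_norm (fun s : S => 1 / μ s) s)
  set m := ‖fun s : S => 1 / μ s‖
  have hK : 0 < (Fintype.card A : ℝ) := by exact_mod_cast Fintype.card_pos
  set K := (Fintype.card A : ℝ)
  have h4 : stepCount M.discount R m (Fintype.card A) e h = 4 * b * K ^ 2 / e * m := by
    rw [stepCount, hb]; field_simp; exact mul_comm _ _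
  -- The bandit at `s` needs a number of steps proportional to `1 / μ s`; the factor `m` covers the
  -- worst state.
  have h5 : 4 * b * K ^ 2 / e * (1 / μ s) ≤ N + 1 :=
    (mul_le_mul_of_nonneg_left hm (by positivity)).trans (h4 ▸ hN)
  have h6 : 4 * b * K ^ 2 / e * (1 / μ s) = (2 * K ^ 2 / (η * μ s)) / e := by
    have : η = 1 / (2 * b) := by field_simp; linarith
    rw [this]; field_simp; ring
  rw [h6, div_le_iff₀ he] at h5
  rw [← div_div, div_le_iff₀ (by positivity)]
  linarith

/-- Unrolls `D_{h+1} ≤ γ D_h + e_h` from `V_0 = 0`, where the error is at most `R/(1-γ)`. -/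
theorem abs_optValue_sub_dynPGMemory_le (M : MDP S A) {R : ℝ} (hR : 0 < R)
    (hr : ∀ s a, |M.reward s a| ≤ R) (μ : stdSimplex ℝ S) (hμ : ∀ s, 0 < μ s)
    (θ₀ : ℕ → EuclideanSpace ℝ (S × A))
    (hθ₀ : ∀ h s a, softmaxPolicy (θ₀ h) s a = 1 / (Fintype.card A : ℝ)) {e : ℕ → ℝ} {N : ℕ → ℕ}
    {H : ℕ} (he : ∀ h < H, 0 < e h)
    (hN : ∀ h < H, stepCount M.discount R ‖fun s : S => 1 / μ s‖ (Fintype.card A) (e h) h ≤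
      N h + 1) (s : S) :
    |M.optValue (stdSimplex.vertex s) -
      M.value (stdSimplex.vertex s) (dynPGMemory M μ (stepSize M.discount R) θ₀ N H)| ≤
      M.discount ^ H * (R / (1 - M.discount)) +
        ∑ h ∈ Finset.range H, M.discount ^ (H - h - 1) * e h := by
  induction H generalizing s with
  | zero => simpa [M.value_zero] using M.abs_optValue_le hr s
  | succ H ih =>
    have ih := ih (fun h hh => he h (hh.trans H.lt_succ_self))
      (fun h hh => hN h (hh.trans H.lt_succ_self))
    have h1 := M.abs_optValue_sub_bellman_le hr ih
      (qValue_sub_bellman_dynPGEpoch_le M hR hr μ hμ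
        (dynPGMemory M μ (stepSize M.discount R) θ₀ N H) (θ₀ H) (hθ₀ H) (he H H.lt_succ_self)
        (hN H H.lt_succ_self)) s
    rw [← M.value_vertex_cons] at h1
    refine h1.trans_eq ?_
    rw [Finset.sum_range_succ, mul_add, Finset.mul_sum, pow_succ']
    have h2 : ∑ h ∈ Finset.range H, M.discount * (M.discount ^ (H - h - 1) * e h) =
        ∑ h ∈ Finset.range H, M.discount ^ (H + 1 - h - 1) * e h := by
      refine Finset.sum_congr rfl fun h hh => ?_
      have : H + 1 - h - 1 = (H - h - 1) + 1 := by
        have := Finset.mem_range.1 hh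
        omega
      rw [this, pow_succ']
      ring
    rw [h2]
    simp only [add_tsub_cancel_left, tsub_self, pow_zero, one_mul]
    ring

end Epoch

/-! ### Optimal tolerances and the size of their normalization -/

section Counting

/-- The normalization `∑_{t<H} √((1 - γ^{t+1}) γ^{H-t-1})` of the tolerances. -/
noncomputable def toleranceSum (γ : ℝ) (H : ℕ) : ℝ :=
  ∑ t ∈ Finset.range H, √((1 - γ ^ (t + 1)) * γ ^ (H - t - 1))

variable {γ : ℝ}

theorem one_sub_pow_succ_pos (h0 : 0 < γ) (h1 : γ < 1) (t : ℕ) : 0 < 1 - γ ^ (t + 1) :=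
  sub_pos.2 (pow_lt_one₀ h0.le h1 t.succ_ne_zero)

theorem toleranceSum_pos (h0 : 0 < γ) (h1 : γ < 1) {H : ℕ} (hH : 0 < H) : 0 < toleranceSum γ H :=
  Finset.sum_pos (fun t _ => Real.sqrt_pos.2 (mul_pos (one_sub_pow_succ_pos h0 h1 t)
    (pow_pos h0 _))) ⟨0, Finset.mem_range.2 hH⟩

theorem tolerance_eq (h0 : 0 < γ) (h1 : γ < 1) (d : ℝ) (H h : ℕ) :
    tolerance γ d H h = d / toleranceSum γ H *
      (√((1 - γ ^ (h + 1)) * γ ^ (H - h - 1)) / γ ^ (H - h - 1)) := by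
  have hx := one_sub_pow_succ_pos h0 h1 h
  have hy := pow_pos h0 (H - h - 1)
  rw [tolerance, ← toleranceSum, ← Real.sqrt_inv, inv_div, ← div_eq_mul_inv]
  congr 1
  rw [Real.sqrt_div' _ hy.le, Real.sqrt_mul hx.le, div_eq_div_iff (Real.sqrt_pos.2 hy).ne' hy.ne',
    mul_assoc, Real.mul_self_sqrt hy.le]

theorem tolerance_pos (h0 : 0 < γ) (h1 : γ < 1) {d : ℝ} (hd : 0 < d) {H h : ℕ} (hh : h < H) :
    0 < tolerance γ d H h := by
  rw [tolerance_eq h0 h1]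
  have := toleranceSum_pos h0 h1 (Nat.zero_lt_of_lt hh)
  have := Real.sqrt_pos.2 (mul_pos (one_sub_pow_succ_pos h0 h1 h) (pow_pos h0 (H - h - 1)))
  have := pow_pos h0 (H - h - 1)
  positivity

/-- The tolerances spend the budget `d` exactly; only the empty sum at `H = 0` makes this an
inequality. -/
theorem sum_pow_mul_tolerance_le (h0 : 0 < γ) (h1 : γ < 1) {d : ℝ} (hd : 0 ≤ d) (H : ℕ) :
    ∑ h ∈ Finset.range H, γ ^ (H - h - 1) * tolerance γ d H h ≤ d := by
  have h : ∀ h, γ ^ (H - h - 1) * tolerance γ d H h =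
      d / toleranceSum γ H * √((1 - γ ^ (h + 1)) * γ ^ (H - h - 1)) := fun h => by
    have hy := (pow_pos h0 (H - h - 1)).ne'
    rw [tolerance_eq h0 h1]
    field_simp
  simp only [h, ← Finset.mul_sum]
  rw [← toleranceSum]
  rcases H.eq_zero_or_pos with rfl | hH
  · simpa [toleranceSum] using hd
  · rw [div_mul_cancel₀ _ (toleranceSum_pos h0 h1 hH).ne']

theorem sum_stepCount_tolerance (h0 : 0 < γ) (h1 : γ < 1) {d : ℝ} (hd : 0 < d) (R m : ℝ) (K H : ℕ) :
    ∑ h ∈ Finset.range H, stepCount γ R m K (tolerance γ d H h) h =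
      4 * R * (K : ℝ) ^ 2 * m / ((1 - γ) * d) * toleranceSum γ H ^ 2 := by
  have h : ∀ h ∈ Finset.range H, stepCount γ R m K (tolerance γ d H h) h =
      4 * R * (K : ℝ) ^ 2 * m / ((1 - γ) * d) * toleranceSum γ H *
        √((1 - γ ^ (h + 1)) * γ ^ (H - h - 1)) := fun h hh => by
    have hX := toleranceSum_pos h0 h1 (Nat.zero_lt_of_lt (Finset.mem_range.1 hh))
    have hx := one_sub_pow_succ_pos h0 h1 h
    have hy := pow_pos h0 (H - h - 1)
    have hs := Real.sqrt_pos.2 (mul_pos hx hy)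
    have hs2 := Real.sq_sqrt (mul_pos hx hy).le
    rw [tolerance_eq h0 h1, stepCount]
    have hg : 0 < 1 - γ := sub_pos.2 h1
    set z := √((1 - γ ^ (h + 1)) * γ ^ (H - h - 1))
    field_simp
    rw [hs2]
    ring
  rw [Finset.sum_congr rfl h, ← Finset.mul_sum, ← toleranceSum]
  ring

/-- Cauchy-Schwarz; the squared terms `γ^{H-1-t} - γ^H` sum geometrically. The subtracted `γ^H`
terms are kept as slack for rounding up. -/
theorem toleranceSum_sq_le (h0 : 0 < γ) (h1 : γ < 1) (H : ℕ) :
    toleranceSum γ H ^ 2 ≤ H * ((1 - γ ^ H) / (1 - γ) - H * γ ^ H) := by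
  have hg : 0 < 1 - γ := sub_pos.2 h1
  have h := sq_sum_le_card_mul_sum_sq (s := Finset.range H)
    (f := fun t => √((1 - γ ^ (t + 1)) * γ ^ (H - t - 1)))
  rw [Finset.card_range] at h
  refine h.trans_eq ?_
  congr 1
  have h2 : ∀ t ∈ Finset.range H, √((1 - γ ^ (t + 1)) * γ ^ (H - t - 1)) ^ 2 =
      γ ^ (H - 1 - t) - γ ^ H := fun t ht => by
    have ht := Finset.mem_range.1 ht
    rw [Real.sq_sqrt (mul_pos (one_sub_pow_succ_pos h0 h1 t) (pow_pos h0 _)).le, sub_mul, one_mul,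
      ← pow_add, Nat.sub_right_comm]
    congr 2
    omega
  rw [Finset.sum_congr rfl h2, Finset.sum_sub_distrib, Finset.sum_range_reflect (fun t => γ ^ t) H,
    geom_sum_eq h1.ne, Finset.sum_const, Finset.card_range, nsmul_eq_mul, ← neg_div_neg_eq,
    neg_sub, neg_sub]

/-- A bound uniform in `H`, better than Cauchy-Schwarz for small `γ`. -/
theorem toleranceSum_le (h0 : 0 < γ) (h1 : γ < 1) (H : ℕ) :
    toleranceSum γ H ≤ 1 / (1 - √γ) := by
  have hs : √γ < 1 := by
    rw [Real.sqrt_lt' one_pos, one_pow]; exact h1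
  calc toleranceSum γ H ≤ ∑ t ∈ Finset.range H, √γ ^ (H - 1 - t) := by
        refine Finset.sum_le_sum fun t _ => ?_
        rw [Nat.sub_right_comm, Real.sqrt_le_left (by positivity), ← pow_mul, mul_comm _ 2,
          pow_mul, Real.sq_sqrt h0.le]
        refine mul_le_of_le_one_left (pow_pos h0 _).le ?_
        linarith [pow_pos h0 (t + 1)]
    _ = ∑ t ∈ Finset.range H, √γ ^ t := Finset.sum_range_reflect (fun t => √γ ^ t) H
    _ ≤ ∑' t, √γ ^ t := (summable_geometric_of_lt_one (Real.sqrt_nonneg _) hs).sum_le_tsum _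
        fun t _ => pow_nonneg (Real.sqrt_nonneg _) t
    _ = 1 / (1 - √γ) := by
        rw [tsum_geometric_of_lt_one (Real.sqrt_nonneg _) hs, one_div]

theorem toleranceSum_sq_le_div (h0 : 0 < γ) (h1 : γ < 1) (H : ℕ) :
    toleranceSum γ H ^ 2 ≤ H / (1 - γ) := by
  have hg : 0 < 1 - γ := sub_pos.2 h1
  have hp := pow_pos h0 H
  refine (toleranceSum_sq_le h0 h1 H).trans ?_
  rw [div_eq_mul_one_div (H : ℝ)]
  refine mul_le_mul_of_nonneg_left ?_ (Nat.cast_nonneg H)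
  have : (1 - γ ^ H) / (1 - γ) ≤ 1 / (1 - γ) := by
    gcongr; linarith
  have : 0 ≤ (H : ℝ) * γ ^ H := by positivity
  linarith

/-- The slack in the Cauchy-Schwarz estimate of the tolerance sum that pays for rounding up. -/
theorem toleranceSum_sq_add_le (h0 : 0 < γ) (h1 : γ < 1) {H : ℕ} (hH : 2 ≤ H) :
    toleranceSum γ H ^ 2 + H * γ ^ (H - 1) / 4 ≤ H / (1 - γ) := by
  have hg : 0 < 1 - γ := sub_pos.2 h1
  have hH' : (2 : ℝ) ≤ H := by exact_mod_cast hH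
  have hone : 1 + γ ≤ 1 / (1 - γ) := by
    rw [le_div_iff₀ hg]; nlinarith
  have hp := pow_pos h0 (H - 1)
  have hpow : γ ^ H = γ * γ ^ (H - 1) := by
    rw [← pow_succ']; congr 1; omega
  -- For `γ ≥ 1/12` the Cauchy-Schwarz slack suffices, as `γ/(1-γ) + Hγ ≥ 3γ ≥ 1/4` when `H ≥ 2`.
  -- For smaller `γ` the uniform bound gives `toleranceSum² ≤ (100/71)² < 2 ≤ H`.
  rcases le_or_gt (1 / 12) γ with h | h
  · have hX := toleranceSum_sq_le h0 h1 H
    have h2 : (1 - γ ^ H) / (1 - γ) = 1 / (1 - γ) - γ ^ H * (1 / (1 - γ)) := by ring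
    have h3 : (H : ℝ) / (1 - γ) = H * (1 / (1 - γ)) := by ring
    rw [h2] at hX
    rw [h3]
    have h4 : γ ^ (H - 1) / 4 ≤ γ ^ H * (1 / (1 - γ)) + H * γ ^ H := by
      rw [hpow]
      have : (1 : ℝ) / 4 ≤ γ * (1 / (1 - γ)) + H * γ := by nlinarith
      nlinarith [mul_le_mul_of_nonneg_left this hp.le]
    nlinarith
  · have hs : √γ ≤ 29 / 100 := by
      rw [Real.sqrt_le_left (by norm_num)]; linarith
    have hX : toleranceSum γ H ≤ 100 / 71 := by
      refine (toleranceSum_le h0 h1 H).trans ?_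
      rw [div_le_div_iff₀ (by linarith) (by norm_num)]
      linarith
    have hX0 := (toleranceSum_pos h0 h1 (by omega : 0 < H)).le
    have h2 : γ ^ (H - 1) ≤ γ := pow_le_of_le_one h0.le h1.le (by omega)
    have h3 : (H : ℝ) / (1 - γ) = H * (1 / (1 - γ)) := by ring
    rw [h3]
    nlinarith

theorem sum_ceil_le {n : ℕ → ℝ} {H : ℕ} (hn : ∀ h < H, 0 ≤ n h) :
    ∑ h ∈ Finset.range H, (⌈n h⌉₊ : ℝ) ≤ ∑ h ∈ Finset.range H, n h + H := by
  calc ∑ h ∈ Finset.range H, (⌈n h⌉₊ : ℝ) ≤ ∑ h ∈ Finset.range H, (n h + 1) :=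
        Finset.sum_le_sum fun h hh => (Nat.ceil_lt_add_one (hn h (Finset.mem_range.1 hh))).le
    _ = _ := by simp [Finset.sum_add_distrib]

theorem sum_floor_le {n : ℕ → ℝ} {H : ℕ} (hn : ∀ h < H, 0 ≤ n h) :
    ∑ h ∈ Finset.range H, (⌊n h⌋₊ : ℝ) ≤ ∑ h ∈ Finset.range H, n h :=
  Finset.sum_le_sum fun h hh => Nat.floor_le (hn h (Finset.mem_range.1 hh))

/-- Also valid for `x > 1`, where the natural ceiling is 0 and the power is 1. -/
theorem pow_ceil_logb_le (h0 : 0 < γ) (h1 : γ < 1) {x : ℝ} (hx : 0 < x) :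
    γ ^ ⌈Real.logb γ x⌉₊ ≤ x := by
  have h := Nat.le_ceil (Real.logb γ x)
  rw [← Real.rpow_natCast]
  calc γ ^ (⌈Real.logb γ x⌉₊ : ℝ) ≤ γ ^ Real.logb γ x :=
        Real.rpow_le_rpow_of_exponent_ge h0 h1.le h
    _ = x := Real.rpow_logb h0 h1.ne hx

/-- Minimality of the horizon. It bounds `ε` from above, so the step counts are large enough to
absorb rounding. -/
theorem lt_pow_ceil_logb_sub_one (h0 : 0 < γ) (h1 : γ < 1) {x : ℝ} (hx : 0 < x)
    (hpos : 1 ≤ ⌈Real.logb γ x⌉₊) : x < γ ^ (⌈Real.logb γ x⌉₊ - 1) := by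
  have h : ((⌈Real.logb γ x⌉₊ - 1 : ℕ) : ℝ) < Real.logb γ x := Nat.lt_ceil.1 (by omega)
  rw [← Real.rpow_natCast]
  calc x = γ ^ Real.logb γ x := (Real.rpow_logb h0 h1.ne hx).symm
    _ < _ := Real.rpow_lt_rpow_of_exponent_gt h0 h1 h

theorem logb_eq_log_div_log_inv (γ x y : ℝ) :
    Real.logb γ (x / y) = Real.log (y / x) / Real.log (1 / γ) := by
  rw [Real.logb, ← inv_div y x, Real.log_inv, one_div, Real.log_inv, neg_div, div_neg]

end Counting

/-! ### The two error bounds -/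

section Errors

variable {S A : Type*} [Fintype S] [DecidableEq S] [Fintype A] [Nonempty A]

theorem valueError_le (M : MDP S A) {R : ℝ} (hR : 0 < R) (hr : ∀ s a, |M.reward s a| ≤ R)
    (μ : stdSimplex ℝ S) (hμ : ∀ s, 0 < μ s) (θ₀ : ℕ → EuclideanSpace ℝ (S × A))
    (hθ₀ : ∀ h s a, softmaxPolicy (θ₀ h) s a = 1 / (Fintype.card A : ℝ)) {ε : ℝ} (hε : 0 < ε)
    {N : ℕ → ℕ} (hN : ∀ h < valueHorizon M.discount R ε,
      valueStepCount M.discount R ‖fun s : S => 1 / μ s‖ (Fintype.card A) ε h ≤ N h + 1) :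
    valueError M μ (stepSize M.discount R) θ₀ N (valueHorizon M.discount R ε) ≤ ε := by
  have h0 := M.discount_pos
  have h1 := M.discount_lt_one
  have hg : 0 < 1 - M.discount := sub_pos.2 h1
  refine (pi_norm_le_iff_of_nonneg hε.le).2 fun s => ?_
  refine (abs_optValue_sub_dynPGMemory_le M hR hr μ hμ θ₀ hθ₀
    (fun h hh => tolerance_pos h0 h1 (half_pos hε) hh) hN s).trans ?_
  have h2 := sum_pow_mul_tolerance_le h0 h1 (half_pos hε).le (valueHorizon M.discount R ε)
  have h3 : M.discount ^ valueHorizon M.discount R ε ≤ (1 - M.discount) * ε / (2 * R) :=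
    pow_ceil_logb_le h0 h1 (by positivity)
  have h4 : (1 - M.discount) * ε / (2 * R) * (R / (1 - M.discount)) = ε / 2 := by field_simp
  have h5 := mul_le_mul_of_nonneg_right h3 (by positivity : 0 ≤ R / (1 - M.discount))
  linarith

theorem overallError_le (M : MDP S A) {R : ℝ} (hR : 0 < R) (hr : ∀ s a, |M.reward s a| ≤ R)
    (μ : stdSimplex ℝ S) (hμ : ∀ s, 0 < μ s) (θ₀ : ℕ → EuclideanSpace ℝ (S × A))
    (hθ₀ : ∀ h s a, softmaxPolicy (θ₀ h) s a = 1 / (Fintype.card A : ℝ)) {ε : ℝ} (hε : 0 < ε)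
    {N : ℕ → ℕ} (hN : ∀ h ≤ overallHorizon M.discount R ε,
      overallStepCount M.discount R ‖fun s : S => 1 / μ s‖ (Fintype.card A) ε h ≤ N h + 1) :
    overallError M μ (stepSize M.discount R) θ₀ N (overallHorizon M.discount R ε) ≤ ε := by
  have h0 := M.discount_pos
  have h1 := M.discount_lt_one
  have hg : 0 < 1 - M.discount := sub_pos.2 h1
  set H := overallHorizon M.discount R ε with hH
  have hd : 0 < ε * (1 - M.discount) / 6 := by positivity
  have htol : ∀ h < H, overallTolerance M.discount R ε h =
      tolerance M.discount (ε * (1 - M.discount) / 6) H h := fun h hh => by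
    rw [overallTolerance, ← hH, if_pos hh]
  have hlast : overallTolerance M.discount R ε H = (1 - M.discount) * ε / 6 := by
    rw [overallTolerance, ← hH, if_neg (lt_irrefl _)]
  have hmem : ∀ s, |M.optValue (stdSimplex.vertex s) - M.value (stdSimplex.vertex s)
      (dynPGMemory M μ (stepSize M.discount R) θ₀ N H)| ≤ (1 - M.discount) * ε / 3 := fun s => by
    refine (abs_optValue_sub_dynPGMemory_le M hR hr μ hμ θ₀ hθ₀
      (fun h hh => tolerance_pos h0 h1 hd hh)
      (fun h hh => by rw [← htol h hh]; exact hN h hh.le) s).trans ?_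
    have h2 := sum_pow_mul_tolerance_le h0 h1 hd.le H
    have h3 : M.discount ^ H ≤ (1 - M.discount) ^ 2 * ε / (6 * R) :=
      pow_ceil_logb_le h0 h1 (by positivity)
    have h4 : (1 - M.discount) ^ 2 * ε / (6 * R) * (R / (1 - M.discount)) =
        (1 - M.discount) * ε / 6 := by field_simp
    have h5 := mul_le_mul_of_nonneg_right h3 (by positivity : 0 ≤ R / (1 - M.discount))
    linarith
  refine (pi_norm_le_iff_of_nonneg hε.le).2 fun s => ?_
  refine (M.optValue_sub_valueInf_le hr hmem
    (qValue_sub_bellman_dynPGEpoch_le M hR hr μ hμ _ (θ₀ H) (hθ₀ H)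
      (e := (1 - M.discount) * ε / 6) (by positivity) (N := N H)
      (by rw [← hlast]; exact hN H le_rfl)) s).trans ?_
  -- With `D = (1-γ)ε/3` and `e = (1-γ)ε/6` the factor of `ε` is `2γ/3 + 1/6 < 1`.
  rw [div_le_iff₀ hg]
  nlinarith [mul_pos hg hε]

/-- Horizon zero forces `6R ≤ (1-γ)²ε`, so any two values, each at most `R/(1-γ)` in modulus, differ
by at most `ε`. -/
theorem overallError_le_of_horizon_eq_zero (M : MDP S A) {R : ℝ} (hR : 0 < R)
    (hr : ∀ s a, |M.reward s a| ≤ R) (μ : stdSimplex ℝ S) (η : ℕ → ℝ)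
    (θ₀ : ℕ → EuclideanSpace ℝ (S × A)) (N : ℕ → ℕ) {ε : ℝ} (hε : 0 < ε)
    (hH : overallHorizon M.discount R ε = 0) (H : ℕ) : overallError M μ η θ₀ N H ≤ ε := by
  have h0 := M.discount_pos
  have hg : 0 < 1 - M.discount := sub_pos.2 M.discount_lt_one
  have h3 : M.discount ^ overallHorizon M.discount R ε ≤ (1 - M.discount) ^ 2 * ε / (6 * R) :=
    pow_ceil_logb_le h0 M.discount_lt_one (by positivity)
  rw [hH, pow_zero, le_div_iff₀ (by positivity)] at h3
  refine (pi_norm_le_iff_of_nonneg hε.le).2 fun s => ?_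
  refine (abs_sub _ _).trans ((add_le_add (M.abs_optValue_le hr s)
    (M.abs_valueInf_le hr _ _)).trans ?_)
  rw [← add_div, div_le_iff₀ hg]
  nlinarith [mul_pos hg hε]

end Errors

/-! ### Total numbers of gradient steps -/

section Totals

variable {γ R m ε : ℝ} {K : ℕ}

theorem stepCount_nonneg (h0 : 0 < γ) (h1 : γ < 1) (hR : 0 < R) (hm : 0 ≤ m) {e : ℝ} (he : 0 ≤ e)
    (h : ℕ) : 0 ≤ stepCount γ R m K e h := by
  have hg : 0 < 1 - γ := sub_pos.2 h1
  have := one_sub_pow_succ_pos h0 h1 h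
  rw [stepCount]
  positivity

/-- Exhibits the prefactor of `sum_valueStepCount`, leaving only `toleranceSum²` and `H/(1-γ)` to
compare. -/
theorem valueBound_eq (h1 : γ < 1) (hε : 0 < ε) :
    valueBound γ R m K ε =
      4 * (2 * R * (K : ℝ) ^ 2 * m / ((1 - γ) * ε)) * (valueHorizon γ R ε / (1 - γ)) := by
  have hg : 0 < 1 - γ := sub_pos.2 h1
  rw [valueBound, ← logb_eq_log_div_log_inv, ← valueHorizon]
  field_simp
  ring

theorem sum_valueStepCount (h0 : 0 < γ) (h1 : γ < 1) (hε : 0 < ε) :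
    ∑ h ∈ Finset.range (valueHorizon γ R ε), valueStepCount γ R m K ε h =
      4 * (2 * R * (K : ℝ) ^ 2 * m / ((1 - γ) * ε)) *
        toleranceSum γ (valueHorizon γ R ε) ^ 2 := by
  have hg : 0 < 1 - γ := sub_pos.2 h1
  simp only [valueStepCount]
  rw [sum_stepCount_tolerance h0 h1 (half_pos hε)]
  congr 1
  field_simp

theorem valueStepCount_nonneg (h0 : 0 < γ) (h1 : γ < 1) (hR : 0 < R) (hm : 0 ≤ m) (hε : 0 < ε)
    (h : ℕ) (hh : h < valueHorizon γ R ε) : 0 ≤ valueStepCount γ R m K ε h :=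
  stepCount_nonneg h0 h1 hR hm (tolerance_pos h0 h1 (half_pos hε) hh).le h

theorem sum_floor_valueStepCount_le (h0 : 0 < γ) (h1 : γ < 1) (hR : 0 < R) (hm : 0 ≤ m)
    (hε : 0 < ε) : ∑ h ∈ Finset.range (valueHorizon γ R ε),
      (⌊valueStepCount γ R m K ε h⌋₊ : ℝ) ≤ valueBound γ R m K ε := by
  have hg : 0 < 1 - γ := sub_pos.2 h1
  refine (sum_floor_le (valueStepCount_nonneg h0 h1 hR hm hε)).trans ?_
  rw [sum_valueStepCount h0 h1 hε, valueBound_eq h1 hε]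
  exact mul_le_mul_of_nonneg_left (toleranceSum_sq_le_div h0 h1 _) (by positivity)

theorem sum_ceil_valueStepCount_le (h0 : 0 < γ) (h1 : γ < 1) (hR : 0 < R) (hm : 1 ≤ m)
    (hK : 1 ≤ K) (hε : 0 < ε) (hH : 2 ≤ valueHorizon γ R ε) :
    ∑ h ∈ Finset.range (valueHorizon γ R ε),
      (⌈valueStepCount γ R m K ε h⌉₊ : ℝ) ≤ valueBound γ R m K ε := by
  have hg : 0 < 1 - γ := sub_pos.2 h1
  have hm0 : 0 ≤ m := zero_le_one.trans hm
  refine (sum_ceil_le (valueStepCount_nonneg h0 h1 hR hm0 hε)).trans ?_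
  rw [sum_valueStepCount h0 h1 hε, valueBound_eq h1 hε]
  have hlt : (1 - γ) * ε / (2 * R) < γ ^ (valueHorizon γ R ε - 1) :=
    lt_pow_ceil_logb_sub_one h0 h1 (by positivity) (one_le_two.trans hH)
  have hslack := toleranceSum_sq_add_le h0 h1 hH
  set H := valueHorizon γ R ε
  -- Then the slack `4C · Hγ^{H-1}/4` is at least `H`, the cost of rounding up.
  have hC : 1 ≤ 2 * R * (K : ℝ) ^ 2 * m / ((1 - γ) * ε) * γ ^ (H - 1) := by
    have hKm : 1 ≤ (K : ℝ) ^ 2 * m :=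
      one_le_mul_of_one_le_of_one_le (one_le_pow₀ (by exact_mod_cast hK)) hm
    calc 1 ≤ (K : ℝ) ^ 2 * m := hKm
      _ = 2 * R * (K : ℝ) ^ 2 * m / ((1 - γ) * ε) * ((1 - γ) * ε / (2 * R)) := by field_simp
      _ ≤ _ := mul_le_mul_of_nonneg_left hlt.le (by positivity)
  have hC0 : 0 ≤ 2 * R * (K : ℝ) ^ 2 * m / ((1 - γ) * ε) := by positivity
  set C := 2 * R * (K : ℝ) ^ 2 * m / ((1 - γ) * ε)
  have h2 := mul_le_mul_of_nonneg_left hslack hC0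
  have h3 := mul_le_mul_of_nonneg_left hC (Nat.cast_nonneg (α := ℝ) H)
  linarith

theorem overallBound_eq (h1 : γ < 1) (hε : 0 < ε) :
    overallBound γ R m K ε =
      8 * (6 * R * (K : ℝ) ^ 2 * m / ((1 - γ) ^ 2 * ε)) * (overallHorizon γ R ε / (1 - γ)) := by
  have hg : 0 < 1 - γ := sub_pos.2 h1
  rw [overallBound, ← logb_eq_log_div_log_inv, ← overallHorizon]
  field_simp
  ring

theorem sum_overallStepCount (h0 : 0 < γ) (h1 : γ < 1) (hε : 0 < ε) :
    ∑ h ∈ Finset.range (overallHorizon γ R ε + 1), overallStepCount γ R m K ε h =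
      4 * (6 * R * (K : ℝ) ^ 2 * m / ((1 - γ) ^ 2 * ε)) *
        (toleranceSum γ (overallHorizon γ R ε) ^ 2 + (1 - γ ^ (overallHorizon γ R ε + 1))) := by
  have hg : 0 < 1 - γ := sub_pos.2 h1
  have h2 : ∀ h ∈ Finset.range (overallHorizon γ R ε), overallStepCount γ R m K ε h =
      stepCount γ R m K (tolerance γ (ε * (1 - γ) / 6) (overallHorizon γ R ε) h) h :=
    fun h hh => by
      rw [overallStepCount, overallTolerance, if_pos (Finset.mem_range.1 hh)]
  rw [Finset.sum_range_succ, Finset.sum_congr rfl h2,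
    sum_stepCount_tolerance h0 h1 (by positivity), overallStepCount, overallTolerance,
    if_neg (lt_irrefl _), stepCount]
  field_simp

theorem overallStepCount_nonneg (h0 : 0 < γ) (h1 : γ < 1) (hR : 0 < R) (hm : 0 ≤ m) (hε : 0 < ε)
    (h : ℕ) : 0 ≤ overallStepCount γ R m K ε h := by
  have hg : 0 < 1 - γ := sub_pos.2 h1
  refine stepCount_nonneg h0 h1 hR hm ?_ h
  rw [overallTolerance]
  split_ifs with hh
  · exact (tolerance_pos h0 h1 (by positivity) hh).le
  · positivity

theorem sum_floor_overallStepCount_le (h0 : 0 < γ) (h1 : γ < 1) (hR : 0 < R) (hm : 0 ≤ m)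
    (hε : 0 < ε) (hH : 1 ≤ overallHorizon γ R ε) :
    ∑ h ∈ Finset.range (overallHorizon γ R ε + 1),
      (⌊overallStepCount γ R m K ε h⌋₊ : ℝ) ≤ overallBound γ R m K ε := by
  have hg : 0 < 1 - γ := sub_pos.2 h1
  refine (sum_floor_le fun h _ => overallStepCount_nonneg h0 h1 hR hm hε h).trans ?_
  rw [sum_overallStepCount h0 h1 hε, overallBound_eq h1 hε]
  have hX := toleranceSum_sq_le_div h0 h1 (overallHorizon γ R ε)
  have hp := pow_pos h0 (overallHorizon γ R ε + 1)
  have hH' : (1 : ℝ) ≤ overallHorizon γ R ε := by exact_mod_cast hH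
  -- The final epoch adds at most 1 to `toleranceSum²`; the doubled prefactor of the bound absorbs
  -- it once `H ≥ 1`.
  have h2 : 1 ≤ overallHorizon γ R ε / (1 - γ) := by
    rw [le_div_iff₀ hg]; linarith
  have hC0 : 0 ≤ 6 * R * (K : ℝ) ^ 2 * m / ((1 - γ) ^ 2 * ε) := by positivity
  nlinarith

theorem sum_ceil_overallStepCount_le (h0 : 0 < γ) (h1 : γ < 1) (hR : 0 < R) (hm : 1 ≤ m)
    (hK : 1 ≤ K) (hε : 0 < ε) (hH : 2 ≤ overallHorizon γ R ε) :
    ∑ h ∈ Finset.range (overallHorizon γ R ε + 1),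
      (⌈overallStepCount γ R m K ε h⌉₊ : ℝ) ≤ overallBound γ R m K ε := by
  have hg : 0 < 1 - γ := sub_pos.2 h1
  have hm0 : 0 ≤ m := zero_le_one.trans hm
  refine (sum_ceil_le fun h _ => overallStepCount_nonneg h0 h1 hR hm0 hε h).trans ?_
  rw [sum_overallStepCount h0 h1 hε, overallBound_eq h1 hε]
  have hlt : (1 - γ) ^ 2 * ε / (6 * R) < γ ^ (overallHorizon γ R ε - 1) :=
    lt_pow_ceil_logb_sub_one h0 h1 (by positivity) (one_le_two.trans hH)
  have hX := toleranceSum_sq_le_div h0 h1 (overallHorizon γ R ε)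
  have hp := pow_pos h0 (overallHorizon γ R ε + 1)
  have hH' : (2 : ℝ) ≤ overallHorizon γ R ε := by exact_mod_cast hH
  push_cast
  set H := overallHorizon γ R ε
  have hC : 1 ≤ 6 * R * (K : ℝ) ^ 2 * m / ((1 - γ) ^ 2 * ε) := by
    have hKm : 1 ≤ (K : ℝ) ^ 2 * m :=
      one_le_mul_of_one_le_of_one_le (one_le_pow₀ (by exact_mod_cast hK)) hm
    have hle : (1 - γ) ^ 2 * ε / (6 * R) ≤ 1 := hlt.le.trans (pow_le_one₀ h0.le h1.le)
    rw [div_le_one (by positivity)] at hle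
    rw [one_le_div (by positivity)]
    nlinarith
  set C := 6 * R * (K : ℝ) ^ 2 * m / ((1 - γ) ^ 2 * ε)
  have hHg : (H : ℝ) ≤ H / (1 - γ) := by
    rw [le_div_iff₀ hg]
    nlinarith
  have h2 : 4 * C * (toleranceSum γ H ^ 2 + (1 - γ ^ (H + 1))) ≤ 4 * C * (H / (1 - γ) + 1) :=
    mul_le_mul_of_nonneg_left (by linarith) (by linarith)
  -- What remains is `H + 1 ≤ 4C(H/(1-γ) - 1)`, which follows from `H + 1 ≤ 4(H - 1)` for `H ≥ 2`.
  have h3 : (H : ℝ) - 1 ≤ C * (H / (1 - γ) - 1) := by nlinarith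
  linarith

end Totals

/-! ### The main theorem -/

theorem mainTheorem4 {S A : Type*} [Fintype S] [DecidableEq S] [Fintype A] [Nonempty A]
    (M : MDP S A) (R : ℝ) (hR : 0 < R) (hr : ∀ s a, |M.reward s a| ≤ R)
    (μ : stdSimplex ℝ S) (hμ : ∀ s, 0 < μ s)
    (θ₀ : ℕ → EuclideanSpace ℝ (S × A))
    (hθ₀ : ∀ h s a, softmaxPolicy (θ₀ h) s a = 1 / (Fintype.card A : ℝ))
    (ε : ℝ) (hε : 0 < ε)
    (γ : ℝ) (hγ : γ = M.discount)
    (m : ℝ) (hm : m = ‖fun s : S => 1 / μ s‖)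
    (K : ℕ) (hK : K = Fintype.card A)
    (η : ℕ → ℝ) (hη : η = stepSize γ R) :
    -- overall error of the stationary policy, horizon `H`, real step counts `n`
    (∀ (H : ℕ) (n : ℕ → ℝ), H = overallHorizon γ R ε → n = overallStepCount γ R m K ε →
      overallError M μ η θ₀ (fun h => ⌈n h⌉₊) H ≤ ε ∧
      overallError M μ η θ₀ (fun h => ⌊n h⌋₊) H ≤ ε ∧
      (2 ≤ H → ∑ h ∈ Finset.range (H + 1), (⌈n h⌉₊ : ℝ) ≤ overallBound γ R m K ε) ∧
      (1 ≤ H → ∑ h ∈ Finset.range (H + 1), (⌊n h⌋₊ : ℝ) ≤ overallBound γ R m K ε) ∧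
      (H = 0 → overallError M μ η θ₀ (fun _ => 0) H ≤ ε)) ∧
    -- value function error of the non-stationary policy
    (∀ (H : ℕ) (n : ℕ → ℝ), H = valueHorizon γ R ε → n = valueStepCount γ R m K ε →
      valueError M μ η θ₀ (fun h => ⌈n h⌉₊) H ≤ ε ∧
      valueError M μ η θ₀ (fun h => ⌊n h⌋₊) H ≤ ε ∧
      (2 ≤ H → ∑ h ∈ Finset.range H, (⌈n h⌉₊ : ℝ) ≤ valueBound γ R m K ε) ∧
      ∑ h ∈ Finset.range H, (⌊n h⌋₊ : ℝ) ≤ valueBound γ R m K ε) := by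
  subst hγ hm hK hη
  have h0 := M.discount_pos
  have h1 := M.discount_lt_one
  have hm : 1 ≤ ‖fun s : S => 1 / μ s‖ := by
    -- A state exists because the weights of `μ` sum to 1.
    obtain ⟨s⟩ : Nonempty S := by
      by_contra hS
      rw [not_nonempty_iff] at hS
      simpa using stdSimplex.sum_eq_one μ
    refine le_trans ?_ ((le_abs_self _).trans (norm_le_pi_norm (fun s : S => 1 / μ s) s))
    rw [one_le_div (hμ s)]
    exact stdSimplex.le_one μ s
  have hm0 := zero_le_one.trans hm
  have hK : 1 ≤ Fintype.card A := Fintype.card_pos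
  have hceil : ∀ x : ℝ, x ≤ (⌈x⌉₊ : ℝ) + 1 := fun x => by linarith [Nat.le_ceil x]
  have hfloor : ∀ x : ℝ, x ≤ (⌊x⌋₊ : ℝ) + 1 := fun x => (Nat.lt_floor_add_one x).le
  refine ⟨?_, ?_⟩
  · rintro H n rfl rfl
    exact ⟨overallError_le M hR hr μ hμ θ₀ hθ₀ hε fun h _ => hceil _,
      overallError_le M hR hr μ hμ θ₀ hθ₀ hε fun h _ => hfloor _,
      sum_ceil_overallStepCount_le h0 h1 hR hm hK hε,
      sum_floor_overallStepCount_le h0 h1 hR hm0 hε,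
      fun hH => overallError_le_of_horizon_eq_zero M hR hr μ _ θ₀ _ hε hH _⟩
  · rintro H n rfl rfl
    exact ⟨valueError_le M hR hr μ hμ θ₀ hθ₀ hε fun h _ => hceil _,
      valueError_le M hR hr μ hμ θ₀ hθ₀ hε fun h _ => hfloor _,
      sum_ceil_valueStepCount_le h0 h1 hR hm hK hε,
      sum_floor_valueStepCount_le h0 h1 hR hm0 hε⟩
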